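/- **Setting.** Let $U\subset\mathbb R^m$ be compact, let $G,G_1\subseteq\mathbb R^n$ be open domains (nonempty, open, connected) with $\bar G\subseteq G_1$ and $0\in G$, and let $f\colon G_1\times U\to\mathbb R^n$ be continuous. Controls $u(\cdot)\in\mathcal U$ are the Lebesgue measurable functions $u\colon[0,\infty)\to U$; $x(\cdot;x_0,u(\cdot))$ denotes the Carathéodory solution of $\dot x=f(x,u)$, $x(0)=x_0$. Assume: 1. (System) Any trajectory in $G_1$ defined on some $[0,T)$, $0<T\le+\infty$, with $x_0\in G$ and $u(\cdot)\in\mathcal U$ stays in $G$. For every $R>0$ there is $C_{1,R}>0$ with $\|f(x,u)-f(x',u)\|\le C_{1,R}\|x-x'\|$ for all $x,x'\in\bar B_R(0)\cap\bar G$, $u\in U$. There are a $C^1$ function $Y\colon G_1\to[0,\infty)$ that is proper (preimages of compact sets are compact) and $C_2>0$ with $\sup_{u\in U}\langle DY(x),f(x,u)\rangle\le C_2Y(x)$ on $G_1$. The set $f(x,U)$ is convex for every $x\in\bar G$. (Under these conditions trajectories from $G$ exist uniquely on $[0,\infty)$.) 2. (Local control Lyapunov function) $\Omega\subseteq G$ is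 an open domain with $0\in\Omega$; $V_{\rm loc}\colon\bar\Omega\to[0,\infty)$ is continuous, proper, positive definite, and locally Lipschitz in $\Omega$; for some continuous positive definite $W_{\rm loc}\colon\Omega\to[0,\infty)$ one has $\inf_{u\in U}\partial^-V_{\rm loc}(x;f(x,u))\le-W_{\rm loc}(x)$ for all $x\in\Omega$, where $\partial^-\varphi(x;v)=\liminf_{t\downarrow0,\,w\to v}(\varphi(x+tw)-\varphi(x))/t$. There are constants $c,C_3>0$ such that $\{x\in\bar\Omega:V_{\rm loc}(x)<c\}$ is an open domain whose closure is $\Omega_c:=\{x\in\bar\Omega:V_{\rm loc}(x)\le c\}$, $\Omega_c+B_{C_3}(0)\subseteq\Omega$, and $\partial\Omega_c=\{x\in\bar\Omega:V_{\rm loc}(x)=c\}$. Moreover $\lim_{\varepsilon\to+0}\sup\{\|x\|:x\in\bar\Omega,\ V_{\rm loc}(x)\le\varepsilon\}=0$. 3. (Running cost) $g\colon\bar G\times U\to[0,\infty)$ is continuous; for every $R>0$ there is $C_{5,R}>0$ with $|g(x,u)-g(x',u)|\le C_{5,R}\|x-x'\|$ for $x,x'\in\bar B_R(0)\cap\bar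 G$, $u\in U$; $g(x,u)>0$ for $x\in G\setminus\{0\}$, $u\in U$; $\inf\{g(x,u):x\in G\setminus\operatorname{int}\Omega_c,\ u\in U\}>0$; and there are $C_7,C_8>0$ with $g(x,u)\ge C_8\|f(x,u)\|$ for all $x\in G\setminus B_{C_7}(0)$, $u\in U$. Let $\mathcal D_0$ be the set of $x_0\in G$ for which some $u(\cdot)\in\mathcal U$ gives $\lim_{t\to\infty}\|x(t;x_0,u(\cdot))\|=0$. Put $T_{\Omega_c}(x_0,u(\cdot))=\inf\{T\ge0:x(T;x_0,u(\cdot))\in\Omega_c\}$ ($\inf\emptyset=+\infty$), and define $V$ by $V=V_{\rm loc}$ on $\Omega_c$ and $$V(x_0)=\inf_{u(\cdot)\in\mathcal U:\ T_{\Omega_c}(x_0,u(\cdot))<\infty}\left\{\int_0^{T_{\Omega_c}(x_0,u(\cdot))}g(x(t;x_0,u(\cdot)),u(t))\,dt+c\right\},\qquad x_0\in G\setminus\Omega_c.$$ **Proposition.** Under these assumptions: 1. $V$ is finite and locally Lipschitz continuous in $\mathcal D_0$. 2. The set $\mathcal D_0\setminus\Omega_c$ is open, and the restriction of $V$ to it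 is a (continuous) viscosity solution of $\max_{u\in U}\{-\langle DV(x),f(x,u)\rangle-g(x,u)\}=0$, $x\in\mathcal D_0\setminus\Omega_c$. 3. For any sequence $\{x^{(k)}\}\subset\mathcal D_0$ satisfying either $\lim_{k\to\infty}x^{(k)}=x'\in\partial\mathcal D_0\cap G$ (a boundary point of $\mathcal D_0$ relative to the state space $G$; simply $x'\in\partial\mathcal D_0$ when $G=\mathbb R^n$) or $\lim_{k\to\infty}\|x^{(k)}\|=+\infty$, one has $\lim_{k\to\infty}V(x^{(k)})=+\infty$. -/

import Mathlib

open Set Filter Topology MeasureTheory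
open scoped NNReal ENNReal

noncomputable section

namespace ExitTime

/-- A function is proper on a set `S` if preimages in `S` of compact sets of reals are compact. -/
def ProperOn {X : Type*} [TopologicalSpace X] (φ : X → ℝ) (S : Set X) : Prop :=
  ∀ M : Set ℝ, IsCompact M → IsCompact (S ∩ φ ⁻¹' M)

/-- Positive definiteness on a set `S` of a normed space. -/
def PosDefOn {X : Type*} [Zero X] (φ : X → ℝ) (S : Set X) : Prop :=
  φ 0 = 0 ∧ ∀ x ∈ S, x ≠ 0 → 0 < φ x

/-- An open domain: an open, nonempty, connected set. -/
def IsOpenDomain {X : Type*} [TopologicalSpace X] (S : Set X) : Prop :=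
  IsOpen S ∧ IsConnected S

/-- The lower Dini derivative (directional subderivate) of `φ` at `x` in the direction `v`:
the lower limit of `(φ (x + t w) - φ x) / t` as `t ↓ 0` and `w → v`. -/
def lowerDini {X : Type*} [NormedAddCommGroup X] [NormedSpace ℝ X] (φ : X → ℝ) (x v : X) : EReal :=
  liminf (fun p : ℝ × X => (((φ (x + p.1 • p.2) - φ x) / p.1 : ℝ) : EReal)) (𝓝[>] 0 ×ˢ 𝓝 v)

/-- `V` is a viscosity solution of `H x (DV x) = 0` on the open set `O`. -/
def IsViscositySolution {n : ℕ}
    (H : EuclideanSpace ℝ (Fin n) → EuclideanSpace ℝ (Fin n) → ℝ)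
    (O : Set (EuclideanSpace ℝ (Fin n))) (V : EuclideanSpace ℝ (Fin n) → ℝ) : Prop :=
  IsOpen O ∧ ContinuousOn V O ∧
    ∀ x ∈ O, ∀ φ : EuclideanSpace ℝ (Fin n) → ℝ, ContDiffAt ℝ 1 φ x →
      (IsLocalMaxOn (fun y => V y - φ y) O x → H x (gradient φ x) ≤ 0) ∧
      (IsLocalMinOn (fun y => V y - φ y) O x → 0 ≤ H x (gradient φ x))

section System

variable {n m : ℕ} (f : EuclideanSpace ℝ (Fin n) → EuclideanSpace ℝ (Fin m) →
  EuclideanSpace ℝ (Fin n)) (U : Set (EuclideanSpace ℝ (Fin m)))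
  (G G₁ Ω : Set (EuclideanSpace ℝ (Fin n)))

/-- Open-loop controls: Lebesgue measurable functions from `[0, ∞)` to `U`. (They are locally
essentially bounded when `U` is compact.) The values on the negative half-line are irrelevant. -/
def IsControl (u : ℝ → EuclideanSpace ℝ (Fin m)) : Prop :=
  AEMeasurable u (volume.restrict (Ici 0)) ∧ ∀ t, 0 ≤ t → u t ∈ U

/-- `x` is a Carathéodory solution on `[0, T)`, `T ≤ ∞`, with values in `S`, of `x' = f (x, u)`,
`x(0) = x₀`, in integrated form. -/
def IsTrajectory (S : Set (EuclideanSpace ℝ (Fin n))) (u : ℝ → EuclideanSpace ℝ (Fin m))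
    (x₀ : EuclideanSpace ℝ (Fin n)) (T : EReal) (x : ℝ → EuclideanSpace ℝ (Fin n)) : Prop :=
  ∀ t : ℝ, 0 ≤ t → (t : EReal) < T →
    x t ∈ S ∧ IntervalIntegrable (fun s => f (x s) (u s)) volume 0 t ∧
      x t = x₀ + ∫ s in (0 : ℝ)..t, f (x s) (u s)

/-- Standing conditions on the control system. -/
structure SystemHyp : Prop where
  compact_U : IsCompact U
  domain_G : IsOpenDomain G
  domain_G₁ : IsOpenDomain G₁
  closure_subset : closure G ⊆ G₁
  zero_mem : (0 : EuclideanSpace ℝ (Fin n)) ∈ G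
  continuous_f : ContinuousOn
    (fun p : EuclideanSpace ℝ (Fin n) × EuclideanSpace ℝ (Fin m) => f p.1 p.2) (G₁ ×ˢ U)
  /-- Strong invariance of `G`. -/
  invariant : ∀ x₀ ∈ G, ∀ u, IsControl U u → ∀ T : EReal, 0 < T → ∀ x,
    IsTrajectory f G₁ u x₀ T x → ∀ t : ℝ, 0 ≤ t → (t : EReal) < T → x t ∈ G
  lipschitz_f : ∀ R : ℝ, 0 < R → ∃ C : ℝ, 0 < C ∧
    ∀ x ∈ Metric.closedBall 0 R ∩ closure G, ∀ x' ∈ Metric.closedBall 0 R ∩ closure G,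
      ∀ u ∈ U, ‖f x u - f x' u‖ ≤ C * ‖x - x'‖
  /-- A function that rules out finite escape times. -/
  growth : ∃ (Y : EuclideanSpace ℝ (Fin n) → ℝ) (C : ℝ), 0 < C ∧ ContDiffOn ℝ 1 Y G₁ ∧
    ProperOn Y G₁ ∧ (∀ x ∈ G₁, 0 ≤ Y x) ∧
    ∀ x ∈ G₁, ∀ u ∈ U, inner ℝ (gradient Y x) (f x u) ≤ C * Y x

/-- Convexity of the sets of admissible velocities. -/
def ConvexVelocities : Prop :=
  ∀ x ∈ closure G, Convex ℝ (f x '' U)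

/-- The region of asymptotic null-controllability. -/
def nullControllable : Set (EuclideanSpace ℝ (Fin n)) :=
  {x₀ | x₀ ∈ G ∧ ∃ u x, IsControl U u ∧ IsTrajectory f G₁ u x₀ ⊤ x ∧
    Tendsto (fun t => ‖x t‖) atTop (𝓝 0)}

variable (Vloc : EuclideanSpace ℝ (Fin n) → ℝ) (c : ℝ)

/-- The sublevel set of the local control Lyapunov function. -/
def sublevel : Set (EuclideanSpace ℝ (Fin n)) :=
  {x | x ∈ closure Ω ∧ Vloc x ≤ c}

/-- `Vloc` (with values of interest on `closure Ω`) is a local control Lyapunov function, and `c`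
is an admissible level. -/
structure LocalCLFHyp : Prop where
  domain_Ω : IsOpenDomain Ω
  subset_G : Ω ⊆ G
  zero_mem : (0 : EuclideanSpace ℝ (Fin n)) ∈ Ω
  continuous : ContinuousOn Vloc (closure Ω)
  nonneg : ∀ x ∈ closure Ω, 0 ≤ Vloc x
  proper : ProperOn Vloc (closure Ω)
  posDef : PosDefOn Vloc (closure Ω)
  decrease : ∃ Wloc : EuclideanSpace ℝ (Fin n) → ℝ, ContinuousOn Wloc Ω ∧
    (∀ x ∈ Ω, 0 ≤ Wloc x) ∧ PosDefOn Wloc Ω ∧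
    ∀ x ∈ Ω, (⨅ u ∈ U, lowerDini Vloc x (f x u)) ≤ ((-Wloc x : ℝ) : EReal)
  lipschitz : LocallyLipschitzOn Ω Vloc
  level_pos : 0 < c
  domain_lt : IsOpenDomain {x | x ∈ closure Ω ∧ Vloc x < c}
  closure_lt : closure {x | x ∈ closure Ω ∧ Vloc x < c} = sublevel Ω Vloc c
  thickening : ∃ C : ℝ, 0 < C ∧ ∀ x ∈ sublevel Ω Vloc c, ∀ y ∈ Metric.ball 0 C, x + y ∈ Ω
  frontier_eq : frontier (sublevel Ω Vloc c) = {x | x ∈ closure Ω ∧ Vloc x = c}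
  small : Tendsto (fun ε : ℝ => sSup ((fun x => ‖x‖) '' {x | x ∈ closure Ω ∧ Vloc x ≤ ε}))
    (𝓝[>] 0) (𝓝 0)

variable (g : EuclideanSpace ℝ (Fin n) → EuclideanSpace ℝ (Fin m) → ℝ)

/-- Conditions on the running cost; `K` is the target set. -/
structure RunningCostHyp (K : Set (EuclideanSpace ℝ (Fin n))) : Prop where
  continuous : ContinuousOn
    (fun p : EuclideanSpace ℝ (Fin n) × EuclideanSpace ℝ (Fin m) => g p.1 p.2) (closure G ×ˢ U)
  nonneg : ∀ x ∈ closure G, ∀ u ∈ U, 0 ≤ g x u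
  lipschitz : ∀ R : ℝ, 0 < R → ∃ C : ℝ, 0 < C ∧
    ∀ x ∈ Metric.closedBall 0 R ∩ closure G, ∀ x' ∈ Metric.closedBall 0 R ∩ closure G,
      ∀ u ∈ U, |g x u - g x' u| ≤ C * ‖x - x'‖
  pos : ∀ x ∈ G, x ≠ 0 → ∀ u ∈ U, 0 < g x u
  inf_pos : ∃ C : ℝ, 0 < C ∧ ∀ x ∈ G \ interior K, ∀ u ∈ U, C ≤ g x u

/-- Far from the origin the running cost dominates the speed. -/
def CostDominatesSpeed : Prop :=
  ∃ R C : ℝ, 0 < R ∧ 0 < C ∧ ∀ x ∈ G \ Metric.ball 0 R, ∀ u ∈ U, C * ‖f x u‖ ≤ g x u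

/-- The first time at which the path `x` is in `K` (infinite if there is none). -/
def hitTime (K : Set (EuclideanSpace ℝ (Fin n))) (x : ℝ → EuclideanSpace ℝ (Fin n)) : ℝ≥0∞ :=
  ⨅ (T : ℝ) (_ : 0 ≤ T ∧ x T ∈ K), ENNReal.ofReal T

/-- The value function of the exit-time problem with target `K` and terminal cost `c`, with values
in `[0, ∞]`; the infimum over the empty set is `∞`. -/
def exitValue (K : Set (EuclideanSpace ℝ (Fin n))) (x₀ : EuclideanSpace ℝ (Fin n)) : ℝ≥0∞ :=
  ⨅ (u : ℝ → EuclideanSpace ℝ (Fin m)) (x : ℝ → EuclideanSpace ℝ (Fin n))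
    (_ : IsControl U u ∧ IsTrajectory f G₁ u x₀ ⊤ x ∧ hitTime K x < ⊤),
    (∫⁻ t in Ioc 0 (hitTime K x).toReal, ENNReal.ofReal (g (x t) (u t))) + ENNReal.ofReal c

open Classical in
/-- The glued function: `Vloc` on its sublevel set, the exit-time value function outside. -/
def gluedValue (x₀ : EuclideanSpace ℝ (Fin n)) : ℝ≥0∞ :=
  if x₀ ∈ sublevel Ω Vloc c then ENNReal.ofReal (Vloc x₀)
  else exitValue f U G₁ c g (sublevel Ω Vloc c) x₀

/-- `max_{u ∈ U} (-⟨p, f (x, u)⟩ - g (x, u))`; the supremum is a maximum when `U` is compact and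
nonempty and `f`, `g` are continuous in `u`. -/
def hamiltonian (x p : EuclideanSpace ℝ (Fin n)) : ℝ :=
  sSup ((fun u => -inner ℝ p (f x u) - g x u) '' U)

end System

end ExitTime

end

/-! The proof compares the exit-time problem started at two nearby points. If the exit value at `x`
is at most `M`, then, since the running cost is bounded below off the target, near-optimal controls
reach `Ω_c` within a time bounded in terms of `M`. Over such a time trajectories depend
Lipschitz-continuously on the initial state, so the same control brings a nearby `y` to a distance
at most a constant times `‖x - y‖` from `Ω_c`. The local control Lyapunov function then steers it
into `Ω_c` at a cost proportional to that distance (`exists_near_target`). The result is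
`exists_local_comparison`: `y` is null-controllable and its value exceeds that of `x` by at most a
multiple of `‖x - y‖`.

The comparison is local around any point of `G`, null-controllable or not. Around a point of `D₀` it
yields openness of `D₀` and the Lipschitz estimate. Around a boundary point of `D₀` it yields
blow-up: bounded values nearby would put the boundary point into the open set `D₀`. Blow-up at
infinity is separate: far out the cost dominates the speed, so the cost is at least a multiple of
the distance travelled (`exists_linear_growth`). On `Ω_c` the exit value is `c`, and the glued
function is the exit value plus the correction `min (Vloc - c) 0`, itself locally Lipschitz. The
equation follows from the dynamic programming principle tested on short times.

Two ingredients need work. Since `Vloc` decreases only in the sense of a lower Dini derivative, each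
state offers single short steps of decrease; `exists_reach_level` chains them by a greedy
continuation. Null-controllability near the origin (`mem_nullControllable_of_level`) runs through
the levels `c₁ / 2 ^ k`; the stages may end in finite time at the origin, and the trajectory must
then remain there. This is where convexity of the velocity sets enters: by separation some control
value makes the origin an equilibrium (`exists_equilibrium`). -/

noncomputable section

namespace ExitTime

/-! ### Existence for Carathéodory equations with bounded right-hand side -/

section Caratheodory

variable {E E' : Type*} [NormedAddCommGroup E] [NormedSpace ℝ E] [FiniteDimensional ℝ E]
  [MeasurableSpace E] [BorelSpace E]
  [NormedAddCommGroup E'] [SecondCountableTopology E'] [MeasurableSpace E'] [BorelSpace E']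

/-- A bounded right-hand side along a continuous path and a measurable control is locally
integrable. -/
theorem intervalIntegrable_comp_of_bounded {F : E → E' → E} (hF : Continuous (fun p : E × E' => F p.1 p.2))
    {M : ℝ} (hM : ∀ x v, ‖F x v‖ ≤ M) {u : ℝ → E'} (hu : Measurable u) {x : ℝ → E}
    (hx : Measurable x) (a b : ℝ) :
    IntervalIntegrable (fun s => F (x s) (u s)) volume a b := by
  have hm : Measurable (fun s => F (x s) (u s)) := hF.measurable.comp (hx.prodMk hu)
  refine (intervalIntegrable_const (c := M)).mono_fun hm.aestronglyMeasurable ?_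
  refine Eventually.of_forall fun s => ?_
  simpa using (hM _ _).trans (le_abs_self M)

/-- The solution of a delayed equation. -/
theorem exists_delayed_solution {F : E → E' → E} (hF : Continuous (fun p : E × E' => F p.1 p.2))
    {M : ℝ≥0} (hM : ∀ x v, ‖F x v‖ ≤ M) {u : ℝ → E'} (hu : Measurable u) (x₀ : E) (T : ℝ)
    {η : ℝ} (hη : 0 < η) :
    ∃ x : ℝ → E, LipschitzWith M x ∧ x 0 = x₀ ∧
      ∀ t ∈ Icc 0 T, x t = x₀ + ∫ s in (0 : ℝ)..t, F (x (s - η)) (u s) := by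
  -- The truncation `max t 0` freezes the path at `x₀` for negative times, which supplies the
  -- history needed by the delay.
  let Φ : (ℝ → E) → ℝ → E := fun x t => x₀ + ∫ s in (0 : ℝ)..max t 0, F (x (s - η)) (u s)
  have hΦ : ∀ x, Continuous x → LipschitzWith M (Φ x) := by
    intro x hx
    refine LipschitzWith.of_dist_le_mul fun t t' => ?_
    have hi : ∀ a b, IntervalIntegrable (fun s => F (x (s - η)) (u s)) volume a b :=
      intervalIntegrable_comp_of_bounded hF hM hu (by fun_prop : Continuous fun s => x (s - η)).measurable
    simp only [Φ, dist_eq_norm, add_sub_add_left_eq_sub]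
    rw [intervalIntegral.integral_interval_sub_left (hi _ _) (hi _ _)]
    refine (intervalIntegral.norm_integral_le_of_norm_le_const fun s _ => hM _ _).trans ?_
    gcongr
    exact abs_max_sub_max_le_abs _ _ _
  let X : ℕ → ℝ → E := fun j => Φ^[j] (fun _ => x₀)
  have hX1 : ∀ j, X (j + 1) = Φ (X j) := fun j => Function.iterate_succ_apply' _ _ _
  have hXl : ∀ j, LipschitzWith M (X j) := by
    intro j
    induction j with
    | zero => exact LipschitzWith.const' x₀
    | succ j ih => rw [hX1]; exact hΦ _ ih.continuous
  -- The integrand looks back by `η`, so each iteration settles one more interval of length `η`, and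
  -- finitely many iterations settle `[0, T]`.
  have hX : ∀ j : ℕ, ∀ t ≤ j * η, X (j + 1) t = X j t := by
    intro j
    induction j with
    | zero =>
      intro t ht
      have ht : t ≤ 0 := by simpa using ht
      simp [X, Φ, ht]
    | succ j ih =>
      intro t ht
      rw [hX1 (j + 1)]
      conv_rhs => rw [hX1 j]
      simp only [Φ]
      congr 1
      refine intervalIntegral.integral_congr fun s hs => ?_
      rw [uIcc_of_le (le_max_right _ _)] at hs
      have hj : (0 : ℝ) ≤ j * η := by positivity
      have : s ≤ (j + 1 : ℕ) * η := by
        rcases le_max_iff.1 hs.2 with h | h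
        · exact h.trans ht
        · push_cast; nlinarith
      have hs' : s - η ≤ j * η := by push_cast at this; linarith
      simp only [ih _ hs']
  obtain ⟨j, hj⟩ := exists_nat_ge (T / η)
  have hjT : T ≤ j * η := (div_le_iff₀ hη).1 hj
  refine ⟨X j, hXl j, ?_, fun t ht => ?_⟩
  · rw [← hX j 0 (by positivity), hX1]; simp [Φ]
  · conv_lhs => rw [← hX j t (ht.2.trans hjT), hX1]
    simp [Φ, max_eq_left ht.1]

/-- Existence of a Carathéodory solution for a bounded continuous right-hand side. -/
theorem exists_caratheodory_solution {F : E → E' → E}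
    (hF : Continuous (fun p : E × E' => F p.1 p.2))
    {M : ℝ≥0} (hM : ∀ x v, ‖F x v‖ ≤ M) {u : ℝ → E'}
    (hu : AEMeasurable u (volume.restrict (Ici 0))) (x₀ : E) {T : ℝ} (hT : 0 ≤ T) :
    ∃ x : ℝ → E, Continuous x ∧ x 0 = x₀ ∧
      ∀ t ∈ Icc 0 T, IntervalIntegrable (fun s => F (x s) (u s)) volume 0 t ∧
        x t = x₀ + ∫ s in (0 : ℝ)..t, F (x s) (u s) := by
  wlog hu' : Measurable u generalizing u
  · obtain ⟨x, hxc, hx0, hx⟩ := this hu.measurable_mk.aemeasurable hu.measurable_mk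
    refine ⟨x, hxc, hx0, fun t ht => ?_⟩
    have hae : ∀ᵐ s ∂volume.restrict (uIoc 0 t), F (x s) (hu.mk u s) = F (x s) (u s) := by
      have : uIoc 0 t ⊆ Ici 0 := by
        rw [uIoc_of_le ht.1]; exact fun s hs => hs.1.le
      filter_upwards [ae_mono (Measure.restrict_mono this le_rfl) hu.ae_eq_mk] with s hs
      rw [hs]
    obtain ⟨h1, h2⟩ := hx t ht
    refine ⟨h1.congr_ae hae, ?_⟩
    rw [h2]
    congr 1
    exact intervalIntegral.integral_congr_ae_restrict hae
  -- Tonelli's scheme: the delayed solutions share the Lipschitz constant `M`, so Arzelà–Ascoli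
  -- gives a uniform limit on `[0, T]` as the delays vanish. The integral passes to the limit by
  -- dominated convergence, using continuity of `F` at each fixed control value.
  let η : ℕ → ℝ := fun k => 1 / ((k : ℝ) + 1)
  have hη : ∀ k, 0 < η k := fun k => Nat.one_div_pos_of_nat
  choose X hXl hX0 hX using fun k => exists_delayed_solution hF hM hu' x₀ T (hη k)
  let Y : ℕ → BoundedContinuousFunction (Icc (0 : ℝ) T) E := fun k =>
    BoundedContinuousFunction.mkOfCompact ⟨fun t => X k t, (hXl k).continuous.comp continuous_subtype_val⟩
  have hcpt : IsCompact (closure (range Y)) := by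
    refine BoundedContinuousFunction.arzela_ascoli (Metric.closedBall x₀ (M * T))
      (isCompact_closedBall _ _) _ ?_ ?_
    · rintro _ t ⟨k, rfl⟩
      have := (hXl k).dist_le_mul t 0
      rw [hX0] at this
      refine this.trans ?_
      rw [Real.dist_0_eq_abs, abs_of_nonneg t.2.1]
      gcongr
      exact t.2.2
    · refine (LipschitzWith.uniformEquicontinuous _ M fun y => ?_).equicontinuous
      obtain ⟨_, k, rfl⟩ := y
      exact ((hXl k).comp (LipschitzWith.subtype_val _)).weaken (by simp)
  obtain ⟨y, -, φ, hφ, hlim⟩ := hcpt.tendsto_subseq fun k => subset_closure (mem_range_self (f := Y) k)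
  let x : ℝ → E := fun t => y (projIcc 0 T hT t)
  have hxc : Continuous x := y.continuous.comp continuous_projIcc
  have hconv : ∀ t ∈ Icc 0 T, Tendsto (fun k => X (φ k) t) atTop (𝓝 (x t)) := by
    intro t ht
    have := (BoundedContinuousFunction.tendsto_iff_tendstoUniformly.1 hlim).tendsto_at
      (⟨t, ht⟩ : Icc (0 : ℝ) T)
    simpa [x, projIcc_of_mem hT ht, Y, Function.comp_def] using this
  have hη0 : Tendsto (fun k => η (φ k)) atTop (𝓝 0) :=
    tendsto_one_div_add_atTop_nhds_zero_nat.comp hφ.tendsto_atTop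
  have hconv' : ∀ t ∈ Icc 0 T, Tendsto (fun k => X (φ k) (t - η (φ k))) atTop (𝓝 (x t)) := by
    intro t ht
    refine (hconv t ht).congr_dist ?_
    refine squeeze_zero (g := fun k => M * η (φ k)) (fun _ => dist_nonneg) (fun k => ?_) (by simpa using hη0.const_mul (M : ℝ))
    refine ((hXl (φ k)).dist_le_mul _ _).trans ?_
    rw [Real.dist_eq, sub_sub_cancel, abs_of_pos (hη _)]
  refine ⟨x, hxc, ?_, fun t ht => ⟨intervalIntegrable_comp_of_bounded hF hM hu' hxc.measurable _ _, ?_⟩⟩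
  · refine tendsto_nhds_unique (hconv 0 ⟨le_rfl, hT⟩) ?_
    simp [hX0]
  refine tendsto_nhds_unique (hconv t ht) ?_
  have : Tendsto (fun k => ∫ s in (0 : ℝ)..t, F (X (φ k) (s - η (φ k))) (u s)) atTop
      (𝓝 (∫ s in (0 : ℝ)..t, F (x s) (u s))) := by
    refine intervalIntegral.tendsto_integral_filter_of_dominated_convergence (fun _ => (M : ℝ)) ?_ ?_
      intervalIntegrable_const ?_
    · refine Eventually.of_forall fun k => ?_
      have : Continuous fun s => X (φ k) (s - η (φ k)) := (hXl _).continuous.comp (by fun_prop)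
      exact (hF.measurable.comp (this.measurable.prodMk hu')).aestronglyMeasurable
    · exact Eventually.of_forall fun k => Eventually.of_forall fun s _ => hM _ _
    · refine Eventually.of_forall fun s hs => ?_
      rw [uIoc_of_le ht.1] at hs
      have hc : Tendsto (fun k => (X (φ k) (s - η (φ k)), u s)) atTop (𝓝 (x s, u s)) :=
        (hconv' s ⟨hs.1.le, hs.2.trans ht.2⟩).prodMk_nhds tendsto_const_nhds
      exact (hF.tendsto (x s, u s)).comp hc
  refine (tendsto_const_nhds.add this).congr fun k => ?_
  exact (hX (φ k) t ht).symm

end Caratheodory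

/-! ### Trajectories: growth bound and continuous dependence -/

section Trajectories

variable {n m : ℕ} {f : EuclideanSpace ℝ (Fin n) → EuclideanSpace ℝ (Fin m) →
  EuclideanSpace ℝ (Fin n)} {U : Set (EuclideanSpace ℝ (Fin m))}
  {G G₁ S : Set (EuclideanSpace ℝ (Fin n))}
  {u v : ℝ → EuclideanSpace ℝ (Fin m)} {x₀ y₀ : EuclideanSpace ℝ (Fin n)} {T : EReal}
  {x y : ℝ → EuclideanSpace ℝ (Fin n)}

theorem IsTrajectory.mono_time (h : IsTrajectory f S u x₀ T x) {T' : EReal} (hT : T' ≤ T) :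
    IsTrajectory f S u x₀ T' x := fun t ht htT => h t ht (htT.trans_le hT)

theorem IsTrajectory.apply_zero (h : IsTrajectory f S u x₀ T x) (hT : 0 < T) : x 0 = x₀ := by
  simpa using (h 0 le_rfl (by exact_mod_cast hT)).2.2

theorem IsTrajectory.intervalIntegrable (h : IsTrajectory f S u x₀ T x) {a b : ℝ} (ha : 0 ≤ a)
    (hab : a ≤ b) (hb : (b : EReal) < T) :
    IntervalIntegrable (fun s => f (x s) (u s)) volume a b :=
  (h b (ha.trans hab) hb).2.1.mono_set (by
    rw [uIcc_of_le hab, uIcc_of_le (ha.trans hab)]; exact Icc_subset_Icc_left ha)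

theorem IsTrajectory.sub_eq_integral (h : IsTrajectory f S u x₀ T x) {a b : ℝ} (ha : 0 ≤ a)
    (hab : a ≤ b) (hb : (b : EReal) < T) :
    x b - x a = ∫ s in a..b, f (x s) (u s) := by
  have haT : (a : EReal) < T := lt_of_le_of_lt (by exact_mod_cast hab) hb
  obtain ⟨-, ia, ea⟩ := h a ha haT
  obtain ⟨-, ib, eb⟩ := h b (ha.trans hab) hb
  rw [ea, eb, add_sub_add_left_eq_sub, intervalIntegral.integral_interval_sub_left ib ia]

theorem IsTrajectory.continuousOn (h : IsTrajectory f S u x₀ T x) {t : ℝ} (ht : (t : EReal) < T) :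
    ContinuousOn x (Icc 0 t) := by
  rcases lt_or_ge t 0 with h0 | h0
  · simp [h0]
  have hi := (h t h0 ht).2.1
  have hc := intervalIntegral.continuousOn_primitive_interval' hi left_mem_uIcc
  rw [uIcc_of_le h0] at hc
  refine (continuousOn_const.add hc : ContinuousOn
    (fun t => x₀ + ∫ s in (0 : ℝ)..t, f (x s) (u s)) _).congr fun s hs => ?_
  exact (h s hs.1 (lt_of_le_of_lt (by exact_mod_cast hs.2) ht)).2.2

theorem IsTrajectory.tendsto_right (h : IsTrajectory f S u x₀ T x) {t : ℝ} (h0 : 0 ≤ t)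
    (ht : (t : EReal) < T) : Tendsto x (𝓝[>] t) (𝓝 (x t)) := by
  obtain ⟨t', htt', ht'⟩ := EReal.exists_between_coe_real ht
  have htt : t < t' := by exact_mod_cast htt'
  have := (h.continuousOn ht').mono (Icc_subset_Icc_left h0) t (left_mem_Icc.2 htt.le)
  rw [← nhdsWithin_Ioc_eq_nhdsGT htt]
  exact this.tendsto.mono_left (nhdsWithin_mono _ Ioc_subset_Icc_self)

theorem IsTrajectory.norm_sub_le (h : IsTrajectory f S u x₀ T x) {a b M : ℝ} (ha : 0 ≤ a)
    (hab : a ≤ b) (hb : (b : EReal) < T) (hM : ∀ s ∈ Icc a b, ‖f (x s) (u s)‖ ≤ M) :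
    ‖x b - x a‖ ≤ M * (b - a) := by
  rw [h.sub_eq_integral ha hab hb, ← abs_of_nonneg (sub_nonneg.2 hab)]
  refine intervalIntegral.norm_integral_le_of_norm_le_const fun s hs => hM s ?_
  rw [uIoc_of_le hab] at hs
  exact Ioc_subset_Icc_self hs

theorem SystemHyp.exists_bound (hsys : SystemHyp f U G G₁) {K : Set (EuclideanSpace ℝ (Fin n))}
    (hK : IsCompact K) (hKG : K ⊆ G₁) : ∃ M : ℝ, 0 < M ∧ ∀ x ∈ K, ∀ u ∈ U, ‖f x u‖ ≤ M := by
  obtain ⟨M, hM⟩ := (hK.prod hsys.compact_U).exists_bound_of_continuousOn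
    (hsys.continuous_f.mono (prod_mono_left hKG))
  exact ⟨max M 1, by positivity, fun x hx u hu => (hM (x, u) ⟨hx, hu⟩).trans (le_max_left _ _)⟩

theorem SystemHyp.subset (hsys : SystemHyp f U G G₁) : G ⊆ G₁ :=
  subset_closure.trans hsys.closure_subset

theorem eventually_abs_sub_inner_le {Y : EuclideanSpace ℝ (Fin n) → ℝ}
    {p x : EuclideanSpace ℝ (Fin n)} (h : HasGradientAt Y p x) {ε : ℝ} (hε : 0 < ε) :
    ∀ᶠ y in 𝓝 x, |Y y - Y x - inner ℝ p (y - x)| ≤ ε * ‖y - x‖ := by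
  have := (hasGradientAt_iff_hasFDerivAt.1 h).isLittleO.def hε
  filter_upwards [this] with y hy
  simpa using hy

theorem continuousOn_gradient {Y : EuclideanSpace ℝ (Fin n) → ℝ} (hG : IsOpen S)
    (hY : ContDiffOn ℝ 1 Y S) : ContinuousOn (gradient Y) S :=
  (LinearIsometryEquiv.continuous _).comp_continuousOn (hY.continuousOn_fderiv_of_isOpen hG le_rfl)

/-- A Lyapunov-type function of exponential growth along trajectories. -/
theorem IsTrajectory.growth_le (hsys : SystemHyp f U G G₁) {Y : EuclideanSpace ℝ (Fin n) → ℝ}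
    {C : ℝ} (hY : ContDiffOn ℝ 1 Y G₁)
    (hYf : ∀ x ∈ G₁, ∀ u ∈ U, inner ℝ (gradient Y x) (f x u) ≤ C * Y x)
    (hu : IsControl U u) (h : IsTrajectory f G₁ u x₀ T x) {t : ℝ} (ht : 0 ≤ t)
    (htT : (t : EReal) < T) : Y (x t) ≤ Y x₀ * Real.exp (C * t) := by
  have hxc := h.continuousOn htT
  have hlt : ∀ s ≤ t, (s : EReal) < T := fun s hs => lt_of_le_of_lt (by exact_mod_cast hs) htT
  have hxG : ∀ s ∈ Icc 0 t, x s ∈ G₁ := fun s hs => (h s hs.1 (hlt s hs.2)).1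
  have hGo : IsOpen G₁ := hsys.domain_G₁.1
  obtain ⟨M, hM0, hM⟩ := hsys.exists_bound (isCompact_Icc.image_of_continuousOn hxc)
    (image_subset_iff.2 hxG)
  have hM' : ∀ s ∈ Icc 0 t, ‖f (x s) (u s)‖ ≤ M := fun s hs =>
    hM _ (mem_image_of_mem _ hs) _ (hu.2 s hs.1)
  -- The control is only measurable, so `x` need not be differentiable at every time. This form of
  -- Grönwall's inequality asks only for a bound on a right lower derivative, which the integral
  -- equation provides at every time.
  have key := le_gronwallBound_of_liminf_deriv_right_le (f := fun s => Y (x s))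
    (f' := fun s => C * Y (x s)) (δ := Y x₀) (K := C) (ε := 0) (a := 0) (b := t)
    (hY.continuousOn.comp hxc hxG) ?_ ?_ (by simp) t ⟨ht, le_rfl⟩
  · simpa [gronwallBound_ε0] using key
  · intro s hs r hr
    have hsI : s ∈ Icc 0 t := Ico_subset_Icc_self hs
    have hxs := hxG s hsI
    set p := gradient Y (x s) with hp
    -- The slack is cut in three: one share for the variation of `C * Y` and of the gradient along
    -- the path, one for the first-order remainder of `Y`, and one left over for strictness.
    set d := (r - C * Y (x s)) / 3 with hd
    have hd0 : 0 < d := by linarith [sub_pos.2 hr]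
    have hgr : HasGradientAt Y p (x s) :=
      ((hY.contDiffAt (hGo.mem_nhds hxs)).differentiableAt (by norm_num)).hasGradientAt
    have hxt := h.tendsto_right hs.1 (hlt s hs.2.le)
    have hψ : Tendsto (fun y => C * Y y + ‖p - gradient Y y‖ * M) (𝓝 (x s)) (𝓝 (C * Y (x s))) := by
      have h1 := (hY.continuousOn.continuousAt (hGo.mem_nhds hxs)).tendsto
      have h2 := ((continuousOn_gradient hGo hY).continuousAt (hGo.mem_nhds hxs)).tendsto
      simpa [hp] using (h1.const_mul C).add (((tendsto_const_nhds (x := p)).sub h2).norm.mul_const M)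
    have hev1 := (hψ.comp hxt).eventually (gt_mem_nhds (show C * Y (x s) < C * Y (x s) + d by linarith))
    have hev2 := hxt.eventually (eventually_abs_sub_inner_le hgr (div_pos hd0 hM0))
    obtain ⟨δ, hδ, hδs⟩ := (mem_nhdsGT_iff_exists_Ioo_subset' hs.2).1 hev1
    refine Eventually.frequently ?_
    filter_upwards [hev2, Ioo_mem_nhdsGT hδ, Ioo_mem_nhdsGT hs.2] with z hz2 hzδ hzt
    have hsz : s ≤ z := hzt.1.le
    have hzT := hlt z hzt.2.le
    have hin : inner ℝ p (x z - x s) ≤ (C * Y (x s) + d) * (z - s) := by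
      rw [h.sub_eq_integral hs.1 hsz hzT]
      have hii := h.intervalIntegrable hs.1 hsz hzT
      have hcl := (innerSL ℝ p).intervalIntegral_comp_comm hii
      simp only [innerSL_apply_apply] at hcl
      rw [← hcl]
      have hii' : IntervalIntegrable (fun σ => inner ℝ p (f (x σ) (u σ))) volume s z :=
        ⟨(innerSL ℝ p).integrable_comp hii.1, (innerSL ℝ p).integrable_comp hii.2⟩
      refine (intervalIntegral.integral_mono_on hsz hii' intervalIntegrable_const
        (g := fun _ => C * Y (x s) + d) fun σ hσ => ?_).trans (by simp; linarith)
      have hσI : σ ∈ Icc 0 t := ⟨hs.1.trans hσ.1, hσ.2.trans hzt.2.le⟩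
      have e1 : inner ℝ p (f (x σ) (u σ)) = inner ℝ (gradient Y (x σ)) (f (x σ) (u σ)) +
          inner ℝ (p - gradient Y (x σ)) (f (x σ) (u σ)) := by
        rw [← inner_add_left]; congr 1; abel
      have e2 := hYf _ (hxG σ hσI) _ (hu.2 σ hσI.1)
      have e3 : inner ℝ (p - gradient Y (x σ)) (f (x σ) (u σ)) ≤ ‖p - gradient Y (x σ)‖ * M :=
        (real_inner_le_norm _ _).trans (by gcongr; exact hM' σ hσI)
      have e4 : C * Y (x σ) + ‖p - gradient Y (x σ)‖ * M < C * Y (x s) + d := by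
        rcases hσ.1.eq_or_lt with rfl | hlt'
        · simpa [hp] using hd0
        · exact hδs ⟨hlt', hσ.2.trans_lt hzδ.2⟩
      linarith
    have hnorm : ‖x z - x s‖ ≤ M * (z - s) := h.norm_sub_le hs.1 hsz hzT fun σ hσ =>
      hM' σ ⟨hs.1.trans hσ.1, hσ.2.trans hzt.2.le⟩
    have hzs : 0 < z - s := sub_pos.2 hzt.1
    have h5 : d / M * ‖x z - x s‖ ≤ d * (z - s) := by
      calc d / M * ‖x z - x s‖ ≤ d / M * (M * (z - s)) := by gcongr
        _ = d * (z - s) := by field_simp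
    rw [inv_mul_lt_iff₀ hzs]
    have h6 := (abs_le.1 hz2).2
    have h7 : (C * Y (x s) + d) * (z - s) + d * (z - s) < (z - s) * r := by
      have : r = C * Y (x s) + 3 * d := by rw [hd]; ring
      rw [this]; nlinarith
    linarith
  · rw [h.apply_zero (lt_of_le_of_lt (by exact_mod_cast ht) htT)]

/-- Continuous dependence on initial data, for a common control. -/
theorem IsTrajectory.norm_sub_le_exp {L : ℝ} {A : Set (EuclideanSpace ℝ (Fin n))}
    (hL : ∀ x ∈ A, ∀ x' ∈ A, ∀ u ∈ U, ‖f x u - f x' u‖ ≤ L * ‖x - x'‖)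
    (hu : IsControl U u) (hx : IsTrajectory f A u x₀ T x) (hy : IsTrajectory f A v y₀ T y)
    {t : ℝ} (ht : 0 ≤ t) (htT : (t : EReal) < T) (huv : ∀ s ∈ Ico 0 t, u s = v s) :
    ‖x t - y t‖ ≤ ‖x₀ - y₀‖ * Real.exp (L * t) := by
  have hlt : ∀ s ≤ t, (s : EReal) < T := fun s hs => lt_of_le_of_lt (by exact_mod_cast hs) htT
  have hT : 0 < T := lt_of_le_of_lt (by exact_mod_cast ht) htT
  have key := le_gronwallBound_of_liminf_deriv_right_le (f := fun s => ‖x s - y s‖)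
    (f' := fun s => L * ‖x s - y s‖) (δ := ‖x₀ - y₀‖) (K := L) (ε := 0) (a := 0) (b := t)
    ((hx.continuousOn htT).sub (hy.continuousOn htT)).norm ?_ ?_ (by simp) t ⟨ht, le_rfl⟩
  · simpa [gronwallBound_ε0] using key
  · intro s hs r hr
    obtain ⟨r', hr1, hr2⟩ := exists_between hr
    have hlim := (((hx.tendsto_right hs.1 (hlt s hs.2.le)).sub
      (hy.tendsto_right hs.1 (hlt s hs.2.le))).norm.const_mul L)
    have hev1 := hlim.eventually (gt_mem_nhds hr1)
    obtain ⟨δ, hδ, hδs⟩ := (mem_nhdsGT_iff_exists_Ioo_subset' hs.2).1 hev1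
    refine Eventually.frequently ?_
    filter_upwards [Ioo_mem_nhdsGT hδ, Ioo_mem_nhdsGT hs.2] with z hzδ hzt
    have hsz : s ≤ z := hzt.1.le
    have hzT := hlt z hzt.2.le
    have hzs : 0 < z - s := sub_pos.2 hzt.1
    have hint : ‖(x z - y z) - (x s - y s)‖ ≤ r' * (z - s) := by
      have : (x z - y z) - (x s - y s) = ∫ σ in s..z, (f (x σ) (u σ) - f (y σ) (v σ)) := by
        rw [intervalIntegral.integral_sub (hx.intervalIntegrable hs.1 hsz hzT)
          (hy.intervalIntegrable hs.1 hsz hzT), ← hx.sub_eq_integral hs.1 hsz hzT,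
          ← hy.sub_eq_integral hs.1 hsz hzT]
        abel
      rw [this, ← abs_of_pos hzs]
      refine intervalIntegral.norm_integral_le_of_norm_le_const_ae ?_
      have hne : ∀ᵐ σ : ℝ, σ ≠ z := by simp [ae_iff]
      filter_upwards [hne] with σ hne hσ
      rw [uIoc_of_le hsz] at hσ
      have hσz : σ < z := lt_of_le_of_ne hσ.2 hne
      have h0σ : 0 ≤ σ := hs.1.trans hσ.1.le
      rw [← huv σ ⟨h0σ, hσz.trans hzt.2⟩]
      have hσT := hlt σ (hσz.trans hzt.2).le
      refine (hL _ (hx σ h0σ hσT).1 _ (hy σ h0σ hσT).1 _ (hu.2 σ h0σ)).trans ?_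
      exact le_of_lt (hδs ⟨hσ.1, hσz.trans hzδ.2⟩)
    rw [inv_mul_lt_iff₀ hzs]
    have := norm_sub_norm_le (x z - y z) (x s - y s)
    nlinarith
  · rw [hx.apply_zero hT, hy.apply_zero hT]

end Trajectories

/-! ### Global solutions, uniqueness and concatenation of controls -/

section Solutions

variable {n m : ℕ} {f : EuclideanSpace ℝ (Fin n) → EuclideanSpace ℝ (Fin m) →
  EuclideanSpace ℝ (Fin n)} {U : Set (EuclideanSpace ℝ (Fin m))}
  {G G₁ S : Set (EuclideanSpace ℝ (Fin n))}
  {u v : ℝ → EuclideanSpace ℝ (Fin m)} {x₀ y₀ : EuclideanSpace ℝ (Fin n)} {T : EReal}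
  {x y : ℝ → EuclideanSpace ℝ (Fin n)}

theorem IsTrajectory.of_mem (h : IsTrajectory f S u x₀ T x) {A : Set (EuclideanSpace ℝ (Fin n))}
    (hA : ∀ t : ℝ, 0 ≤ t → (t : EReal) < T → x t ∈ A) : IsTrajectory f A u x₀ T x :=
  fun t ht htT => ⟨hA t ht htT, (h t ht htT).2⟩

/-- Existence on bounded time intervals. -/
theorem SystemHyp.exists_trajectory_of_real (hsys : SystemHyp f U G G₁) (hx₀ : x₀ ∈ G)
    (hu : IsControl U u) {T : ℝ} (hT : 0 ≤ T) : ∃ x, IsTrajectory f G₁ u x₀ (T : EReal) x := by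
  obtain ⟨Y, C, hC, hY, hYp, hY0, hYf⟩ := hsys.growth
  -- `B` is the a priori bound for `Y` on `[0, T]`. The equation is modified only off `{Y ≤ B + 1}`,
  -- which leaves a margin around `{Y ≤ B}`.
  set B := Y x₀ * Real.exp (C * T) with hB
  have hxG := hsys.subset hx₀
  have hcpt : ∀ b, IsCompact {x | x ∈ G₁ ∧ Y x ≤ b} := fun b => by
    convert hYp (Icc 0 b) isCompact_Icc using 1
    ext x
    simp only [mem_ofPred_eq, mem_inter_iff, mem_preimage, mem_Icc]
    exact ⟨fun h => ⟨h.1, hY0 x h.1, h.2⟩, fun h => ⟨h.1, h.2.2⟩⟩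
  set K := {x | x ∈ G₁ ∧ Y x ≤ B} with hK
  set K' := {x | x ∈ G₁ ∧ Y x ≤ B + 1} with hK'
  have hprod : IsCompact (K' ×ˢ U) := (hcpt _).prod hsys.compact_U
  have : CompactSpace (K' ×ˢ U) := isCompact_iff_compactSpace.1 hprod
  let f₀ : BoundedContinuousFunction (K' ×ˢ U) (EuclideanSpace ℝ (Fin n)) :=
    BoundedContinuousFunction.mkOfCompact ⟨fun p => f p.1.1 p.1.2,
      (hsys.continuous_f.mono (prod_mono_left fun x hx => hx.1)).domRestrict⟩
  -- Tietze extension turns `f` on the compact set `K' ×ˢ U` into a bounded continuous right-hand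
  -- side on the whole space.
  obtain ⟨F, -, hF⟩ := BoundedContinuousFunction.exists_norm_eq_domRestrict_eq hprod.isClosed ℝ f₀
  have hFf : ∀ x ∈ K', ∀ w ∈ U, F (x, w) = f x w := fun x hx w hw => by
    have := DFunLike.congr_fun hF ⟨(x, w), ⟨hx, hw⟩⟩
    exact this
  obtain ⟨x, hxc, hx0, hx⟩ := exists_caratheodory_solution (F := fun x w => F (x, w)) (M := ‖F‖₊)
    (by fun_prop) (fun x w => F.norm_coe_le_norm (x, w)) hu.1 x₀ hT
  refine ⟨x, ?_⟩
  have htraj : ∀ t ≤ T, (∀ s ∈ Ico 0 t, x s ∈ K') → IsTrajectory f G₁ u x₀ (t : EReal) x := by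
    intro t htT hs s hs0 hst
    have hst : s < t := by exact_mod_cast hst
    have hcg : ∀ σ ∈ uIoc 0 s, F (x σ, u σ) = f (x σ) (u σ) := fun σ hσ => by
      rw [uIoc_of_le hs0] at hσ
      exact hFf _ (hs σ ⟨hσ.1.le, hσ.2.trans_lt hst⟩) _ (hu.2 σ hσ.1.le)
    obtain ⟨h1, h2⟩ := hx s ⟨hs0, hst.le.trans htT⟩
    refine ⟨(hs s ⟨hs0, hst⟩).1, h1.congr hcg, ?_⟩
    rw [h2]
    congr 1
    exact intervalIntegral.integral_congr_ae (Eventually.of_forall hcg)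
  -- Continuation: the times up to which the path stays in `K` form a closed set. From such a time
  -- the path remains in `K'` a little longer, hence solves the original equation there, and the
  -- growth bound puts it back into `K`.
  have hsub : Icc 0 T ⊆ {t | ∀ s, 0 ≤ s → x s ∉ K → t ≤ s} := by
    have hKs : K ⊆ K' := fun z hz => ⟨hz.1, hz.2.trans (by linarith)⟩
    have hcl : IsClosed {t | ∀ s, 0 ≤ s → x s ∉ K → t ≤ s} := by
      simp only [ofPred_forall]
      exact isClosed_iInter fun s => isClosed_iInter fun _ => isClosed_iInter fun _ => isClosed_Iic
    refine IsClosed.Icc_subset_of_forall_exists_gt (hcl.inter isClosed_Icc) (fun s hs _ => hs) ?_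
    rintro t ⟨ht, ht0, htT⟩ z hz
    have hlt : ∀ s ∈ Ico 0 t, x s ∈ K := fun s hs => by
      by_contra hc
      exact absurd (ht s hs.1 hc) (not_le.2 hs.2)
    have hYx0 : 0 ≤ Y x₀ := hY0 _ hxG
    have htK : x t ∈ K := by
      rcases ht0.eq_or_lt with rfl | hpos
      · rw [hx0]
        refine ⟨hxG, ?_⟩
        rw [hB]
        exact le_mul_of_one_le_right hYx0 (Real.one_le_exp (by positivity))
      · have hmem : t ∈ closure (Ico 0 t) := by
          rw [closure_Ico hpos.ne]; exact ⟨ht0, le_rfl⟩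
        exact (hcpt B).isClosed.closure_subset_iff.2 (image_subset_iff.2 hlt)
          (hxc.continuousOn.image_closure ⟨t, hmem, rfl⟩)
    have hint : ∀ᶠ s in 𝓝 t, x s ∈ K' := by
      have h1 : ∀ᶠ z in 𝓝 (x t), z ∈ G₁ := hsys.domain_G₁.1.mem_nhds htK.1
      have h2 : ∀ᶠ z in 𝓝 (x t), Y z < B + 1 :=
        (hY.continuousOn.continuousAt (hsys.domain_G₁.1.mem_nhds htK.1)).eventually
          (gt_mem_nhds (by linarith [htK.2]))
      filter_upwards [hxc.continuousAt.eventually (h1.and h2)] with s hs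
      exact ⟨hs.1, hs.2.le⟩
    obtain ⟨δ, hδ, hδs⟩ := Metric.eventually_nhds_iff.1 hint
    set t' := min (t + δ / 2) (min z T) with ht'
    have htt' : t < t' := by
      simp only [ht', lt_min_iff]
      exact ⟨by linarith, hz, htT⟩
    have ht'T : t' ≤ T := (min_le_right _ _).trans (min_le_right _ _)
    have ht'δ : t' ≤ t + δ / 2 := min_le_left _ _
    refine ⟨t', fun s hs0 hsK => ?_, htt', (min_le_right _ _).trans (min_le_left _ _)⟩
    by_contra hc
    push Not at hc
    have hst : s < t' := hc
    have htr := htraj t' ht'T fun σ hσ => by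
      rcases lt_or_ge σ t with h | h
      · exact hKs (hlt σ ⟨hσ.1, h⟩)
      · refine hδs ?_
        rw [Real.dist_eq, abs_of_nonneg (by linarith)]
        linarith [hσ.2]
    refine hsK ⟨(htr s hs0 (by exact_mod_cast hst)).1, ?_⟩
    refine (htr.growth_le hsys hY hYf hu hs0 (by exact_mod_cast hst)).trans ?_
    rw [hB]
    gcongr
    linarith
  refine htraj T le_rfl fun s hs => ?_
  by_contra hc
  refine absurd (hsub ⟨hT, le_rfl⟩ s hs.1 fun h => hc ⟨h.1, h.2.trans (by linarith)⟩) (not_le.2 hs.2)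

/-- The trajectories of two controls agree as long as the controls do. -/
theorem IsTrajectory.eq_of_eqOn (hsys : SystemHyp f U G G₁) (hx₀ : x₀ ∈ G)
    (hu : IsControl U u) (hv : IsControl U v)
    (hx : IsTrajectory f G₁ u x₀ T x) (hy : IsTrajectory f G₁ v x₀ T y)
    {t : ℝ} (htT : (t : EReal) < T) (huv : ∀ s ∈ Ico 0 t, u s = v s) {s : ℝ} (hs : 0 ≤ s)
    (hst : s ≤ t) : x s = y s := by
  obtain ⟨t', htt', ht'T⟩ := EReal.exists_between_coe_real htT
  have htt : t < t' := by exact_mod_cast htt'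
  have hT : 0 < T := lt_of_le_of_lt (by exact_mod_cast hs.trans hst) htT
  -- The Lipschitz constants are available only on bounded parts of `closure G`; invariance places
  -- both trajectories there.
  have hxG := hsys.invariant x₀ hx₀ u hu T hT x hx
  have hyG := hsys.invariant x₀ hx₀ v hv T hT y hy
  have hb : Bornology.IsBounded (x '' Icc 0 t' ∪ y '' Icc 0 t') :=
    ((isCompact_Icc.image_of_continuousOn (hx.continuousOn ht'T)).isBounded).union
      (isCompact_Icc.image_of_continuousOn (hy.continuousOn ht'T)).isBounded
  obtain ⟨R, hR⟩ := hb.subset_closedBall 0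
  obtain ⟨L, -, hL⟩ := hsys.lipschitz_f (max R 1) (by positivity)
  have hsub : Metric.closedBall (0 : EuclideanSpace ℝ (Fin n)) R ⊆ Metric.closedBall 0 (max R 1) :=
    Metric.closedBall_subset_closedBall (le_max_left _ _)
  have key := IsTrajectory.norm_sub_le_exp (v := v) (T := (t' : EReal)) hL hu
    ((hx.mono_time ht'T.le).of_mem fun σ hσ hσt => ⟨hsub (hR (Or.inl ⟨σ,
      ⟨hσ, by exact_mod_cast hσt.le⟩, rfl⟩)), subset_closure (hxG σ hσ (hσt.trans ht'T))⟩)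
    ((hy.mono_time ht'T.le).of_mem fun σ hσ hσt => ⟨hsub (hR (Or.inr ⟨σ,
      ⟨hσ, by exact_mod_cast hσt.le⟩, rfl⟩)), subset_closure (hyG σ hσ (hσt.trans ht'T))⟩)
    hs (by exact_mod_cast hst.trans_lt htt) fun σ hσ => huv σ ⟨hσ.1, hσ.2.trans_le hst⟩
  rw [sub_self, norm_zero, zero_mul] at key
  exact sub_eq_zero.1 (norm_le_zero_iff.1 key)

/-- Global existence. -/
theorem SystemHyp.exists_trajectory (hsys : SystemHyp f U G G₁) (hx₀ : x₀ ∈ G)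
    (hu : IsControl U u) : ∃ x, IsTrajectory f G₁ u x₀ ⊤ x := by
  choose X hX using fun N : ℕ => hsys.exists_trajectory_of_real hx₀ hu
    (show (0 : ℝ) ≤ (N : ℝ) + 1 by positivity)
  have hcg : ∀ s t : ℝ, 0 ≤ s → s ≤ t → X ⌊s⌋₊ s = X ⌊t⌋₊ s := fun s t hs hst =>
    IsTrajectory.eq_of_eqOn (T := ((⌊s⌋₊ + 1 : ℝ) : EReal)) hsys hx₀ hu hu (hX _)
      ((hX ⌊t⌋₊).mono_time (by
        have : (⌊s⌋₊ : ℝ) + 1 ≤ ⌊t⌋₊ + 1 := by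
          have := Nat.floor_mono hst
          exact_mod_cast Nat.succ_le_succ this
        exact_mod_cast this))
      (by exact_mod_cast Nat.lt_floor_add_one s) (fun _ _ => rfl) hs le_rfl
  refine ⟨fun t => X ⌊t⌋₊ t, fun t ht _ => ?_⟩
  obtain ⟨h1, h2, h3⟩ := hX ⌊t⌋₊ t ht (by exact_mod_cast Nat.lt_floor_add_one t)
  have hcg' : ∀ s ∈ uIoc 0 t, f (X ⌊t⌋₊ s) (u s) = f (X ⌊s⌋₊ s) (u s) := fun s hs => by
    rw [uIoc_of_le ht] at hs
    rw [hcg s t hs.1.le hs.2]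
  refine ⟨h1, h2.congr hcg', ?_⟩
  refine h3.trans ?_
  congr 1
  exact intervalIntegral.integral_congr_ae (Eventually.of_forall hcg')

variable (f G₁) in
open Classical in
/-- The trajectory of a control, on the whole half-line. -/
def sol (x₀ : EuclideanSpace ℝ (Fin n)) (u : ℝ → EuclideanSpace ℝ (Fin m)) :
    ℝ → EuclideanSpace ℝ (Fin n) :=
  if h : ∃ x, IsTrajectory f G₁ u x₀ ⊤ x then h.choose else 0

theorem SystemHyp.isTrajectory_sol (hsys : SystemHyp f U G G₁) (hx₀ : x₀ ∈ G)
    (hu : IsControl U u) : IsTrajectory f G₁ u x₀ ⊤ (sol f G₁ x₀ u) := by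
  have h := hsys.exists_trajectory hx₀ hu
  rw [sol, dif_pos h]
  exact h.choose_spec

theorem SystemHyp.sol_mem (hsys : SystemHyp f U G G₁) (hx₀ : x₀ ∈ G) (hu : IsControl U u) {t : ℝ}
    (ht : 0 ≤ t) : sol f G₁ x₀ u t ∈ G :=
  hsys.invariant x₀ hx₀ u hu ⊤ (by simp) _ (hsys.isTrajectory_sol hx₀ hu) t ht (EReal.coe_lt_top t)

theorem SystemHyp.sol_zero (hsys : SystemHyp f U G G₁) (hx₀ : x₀ ∈ G) (hu : IsControl U u) :
    sol f G₁ x₀ u 0 = x₀ := (hsys.isTrajectory_sol hx₀ hu).apply_zero (by simp)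

theorem SystemHyp.eq_sol (hsys : SystemHyp f U G G₁) (hx₀ : x₀ ∈ G) (hu : IsControl U u)
    (hx : IsTrajectory f G₁ u x₀ ⊤ x) {t : ℝ} (ht : 0 ≤ t) : x t = sol f G₁ x₀ u t :=
  IsTrajectory.eq_of_eqOn hsys hx₀ hu hu hx (hsys.isTrajectory_sol hx₀ hu) (EReal.coe_lt_top t)
    (fun _ _ => rfl) ht le_rfl

theorem SystemHyp.sol_congr (hsys : SystemHyp f U G G₁) (hx₀ : x₀ ∈ G) (hu : IsControl U u)
    (hv : IsControl U v) {t : ℝ} (huv : ∀ s ∈ Ico 0 t, u s = v s) {s : ℝ} (hs : 0 ≤ s)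
    (hst : s ≤ t) : sol f G₁ x₀ u s = sol f G₁ x₀ v s :=
  IsTrajectory.eq_of_eqOn hsys hx₀ hu hv (hsys.isTrajectory_sol hx₀ hu)
    (hsys.isTrajectory_sol hx₀ hv) (EReal.coe_lt_top t) huv hs hst

theorem SystemHyp.continuousOn_sol (hsys : SystemHyp f U G G₁) (hx₀ : x₀ ∈ G)
    (hu : IsControl U u) : ContinuousOn (sol f G₁ x₀ u) (Ici 0) := by
  intro t ht
  have := (hsys.isTrajectory_sol hx₀ hu).continuousOn (EReal.coe_lt_top (t + 1))
  refine (this t ⟨ht, by linarith⟩).mono_of_mem_nhdsWithin ?_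
  rw [mem_nhdsWithin]
  exact ⟨Iio (t + 1), isOpen_Iio, by simp, fun s hs => ⟨hs.2, hs.1.le⟩⟩

theorem IsControl.shift (hu : IsControl U u) {τ : ℝ} (hτ : 0 ≤ τ) :
    IsControl U (fun s => u (τ + s)) := by
  refine ⟨?_, fun t ht => hu.2 _ (by positivity)⟩
  have hpre : (fun s => τ + s) ⁻¹' Ici τ = Ici (0 : ℝ) := by ext s; simp
  have hmp := (measurePreserving_add_left (volume : Measure ℝ) τ).restrict_preimage
    (measurableSet_Ici (a := τ))
  rw [hpre] at hmp
  exact (hu.1.mono_measure (Measure.restrict_mono (Ici_subset_Ici.2 hτ) le_rfl)).comp_quasiMeasurePreserving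
    hmp.quasiMeasurePreserving

/-- Follow `u` up to time `τ`, then `v`. -/
def concat (u : ℝ → EuclideanSpace ℝ (Fin m)) (τ : ℝ) (v : ℝ → EuclideanSpace ℝ (Fin m)) :
    ℝ → EuclideanSpace ℝ (Fin m) := fun t => if t < τ then u t else v (t - τ)

theorem IsControl.concat (hu : IsControl U u) (hv : IsControl U v) {τ : ℝ} (hτ : 0 ≤ τ) :
    IsControl U (concat u τ v) := by
  constructor
  · rw [← Ico_union_Ici_eq_Ici hτ, aemeasurable_union_iff]
    constructor
    · refine (hu.1.mono_measure (Measure.restrict_mono Ico_subset_Ici_self le_rfl)).congr ?_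
      filter_upwards [ae_restrict_mem measurableSet_Ico] with t ht
      simp [ExitTime.concat, ht.2]
    · have hpre : (fun s => -τ + s) ⁻¹' Ici 0 = Ici τ := by ext s; simp
      have hmp := (measurePreserving_add_left (volume : Measure ℝ) (-τ)).restrict_preimage
        (measurableSet_Ici (a := 0))
      rw [hpre] at hmp
      refine (hv.1.comp_quasiMeasurePreserving hmp.quasiMeasurePreserving).congr ?_
      filter_upwards [ae_restrict_mem measurableSet_Ici] with t ht
      simp [ExitTime.concat, not_lt.2 (mem_Ici.1 ht), sub_eq_neg_add]
  · intro t ht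
    rw [ExitTime.concat]
    split_ifs with h
    · exact hu.2 t ht
    · exact hv.2 _ (sub_nonneg.2 (not_lt.1 h))

theorem isControl_const {w : EuclideanSpace ℝ (Fin m)} (hw : w ∈ U) : IsControl U (fun _ => w) :=
  ⟨aemeasurable_const, fun _ _ => hw⟩

theorem SystemHyp.sol_add (hsys : SystemHyp f U G G₁) (hx₀ : x₀ ∈ G) (hu : IsControl U u) {τ s : ℝ}
    (hτ : 0 ≤ τ) (hs : 0 ≤ s) :
    sol f G₁ x₀ u (τ + s) = sol f G₁ (sol f G₁ x₀ u τ) (fun s => u (τ + s)) s := by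
  have htr := hsys.isTrajectory_sol hx₀ hu
  refine hsys.eq_sol (x := fun s => sol f G₁ x₀ u (τ + s)) (hsys.sol_mem hx₀ hu hτ) (hu.shift hτ) ?_ hs
  intro t ht _
  have hτt : τ ≤ τ + t := by linarith
  refine ⟨(htr (τ + t) (by positivity) (EReal.coe_lt_top _)).1, ?_, ?_⟩
  · have := (htr.intervalIntegrable hτ hτt (EReal.coe_lt_top _)).comp_add_left (c := τ)
    simpa using this
  · have := htr.sub_eq_integral hτ hτt (EReal.coe_lt_top _)
    rw [intervalIntegral.integral_comp_add_left (fun σ => f (sol f G₁ x₀ u σ) (u σ)), add_zero, ← this]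
    abel

theorem SystemHyp.sol_concat_of_le (hsys : SystemHyp f U G G₁) (hx₀ : x₀ ∈ G) (hu : IsControl U u)
    (hv : IsControl U v) {τ t : ℝ} (ht : 0 ≤ t) (htτ : t ≤ τ) :
    sol f G₁ x₀ (concat u τ v) t = sol f G₁ x₀ u t :=
  hsys.sol_congr hx₀ (hu.concat hv (ht.trans htτ)) hu (fun s hs => by simp [concat, hs.2]) ht htτ

theorem SystemHyp.sol_concat_add (hsys : SystemHyp f U G G₁) (hx₀ : x₀ ∈ G) (hu : IsControl U u)
    (hv : IsControl U v) {τ t : ℝ} (hτ : 0 ≤ τ) (ht : 0 ≤ t) :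
    sol f G₁ x₀ (concat u τ v) (τ + t) = sol f G₁ (sol f G₁ x₀ u τ) v t := by
  have hw := hu.concat hv hτ
  rw [hsys.sol_add hx₀ hw hτ ht, hsys.sol_concat_of_le hx₀ hu hv hτ le_rfl]
  refine hsys.sol_congr (hsys.sol_mem hx₀ hu hτ) (hw.shift hτ) hv (fun s hs => ?_) ht le_rfl
  simp [concat, hs.1]

/-- A sequence of controls, each prolonging the previous one, has a common prolongation. -/
theorem exists_control_of_seq {w : ℕ → ℝ → EuclideanSpace ℝ (Fin m)} {τ : ℕ → ℝ}
    (hw : ∀ k, IsControl U (w k)) (hτ : Monotone τ)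
    (hext : ∀ k, ∀ t ∈ Ico 0 (τ k), w (k + 1) t = w k t) (hv : IsControl U v) :
    ∃ u, IsControl U u ∧ (∀ k, ∀ t ∈ Ico 0 (τ k), u t = w k t) ∧
      ∀ t, (∀ k, τ k ≤ t) → u t = v t := by
  classical
  have hext' : ∀ k j, k ≤ j → ∀ t ∈ Ico 0 (τ k), w j t = w k t := by
    intro k j hkj
    induction j, hkj using Nat.le_induction with
    | base => exact fun _ _ => rfl
    | succ j hkj ih =>
      intro t ht
      rw [hext j t ⟨ht.1, ht.2.trans_le (hτ hkj)⟩, ih t ht]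
  -- The default `v` governs the times beyond all `τ k`. It matters when the `τ k` accumulate at a
  -- finite time and the continuation has to be prescribed.
  let u : ℝ → EuclideanSpace ℝ (Fin m) := fun t =>
    if h : ∃ k, t < τ k then w (Nat.find h) t else v t
  have hu1 : ∀ k, ∀ t ∈ Ico 0 (τ k), u t = w k t := by
    intro k t ht
    have h : ∃ k, t < τ k := ⟨k, ht.2⟩
    simp only [u, dif_pos h]
    exact (hext' _ _ (Nat.find_min' h ht.2) t ⟨ht.1, Nat.find_spec h⟩).symm
  have hu2 : ∀ t, (∀ k, τ k ≤ t) → u t = v t := by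
    intro t ht
    have h : ¬ ∃ k, t < τ k := by push Not; exact ht
    simp only [u, dif_neg h]
  refine ⟨u, ⟨?_, fun t ht => ?_⟩, hu1, hu2⟩
  · have hcov : Ici (0 : ℝ) ⊆ (⋃ k, Ico 0 (τ k)) ∪ (Ici 0 ∩ ⋂ k, Ici (τ k)) := by
      intro t ht
      by_cases h : ∃ k, t < τ k
      · exact Or.inl (mem_iUnion.2 (h.imp fun k hk => ⟨ht, hk⟩))
      · push Not at h
        exact Or.inr ⟨ht, mem_iInter.2 h⟩
    refine AEMeasurable.mono_measure ?_ (Measure.restrict_mono hcov le_rfl)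
    rw [aemeasurable_union_iff, aemeasurable_iUnion_iff]
    constructor
    · intro k
      refine ((hw k).1.mono_measure (Measure.restrict_mono Ico_subset_Ici_self le_rfl)).congr ?_
      filter_upwards [ae_restrict_mem measurableSet_Ico] with t ht
      exact (hu1 k t ht).symm
    · refine (hv.1.mono_measure (Measure.restrict_mono inter_subset_left le_rfl)).congr ?_
      filter_upwards [ae_restrict_mem (measurableSet_Ici.inter
        (MeasurableSet.iInter fun k => measurableSet_Ici))] with t ht
      exact (hu2 t fun k => mem_iInter.1 ht.2 k).symm
  · by_cases h : ∃ k, t < τ k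
    · obtain ⟨k, hk⟩ := h
      rw [hu1 k t ⟨ht, hk⟩]
      exact (hw k).2 t ht
    · push Not at h
      rw [hu2 t h]
      exact hv.2 t ht

/-- In bounded time, the trajectories from a neighbourhood of a point stay in a compact set. -/
theorem SystemHyp.exists_compact_reach (hsys : SystemHyp f U G G₁) (hx₀ : x₀ ∈ G) (T : ℝ) :
    ∃ r > 0, Metric.ball x₀ r ⊆ G ∧ ∃ K, IsCompact K ∧ K ⊆ closure G ∧
      ∀ y ∈ Metric.ball x₀ r, ∀ u, IsControl U u → ∀ t ∈ Icc 0 T, sol f G₁ y u t ∈ K := by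
  obtain ⟨Y, C, hC, hY, hYp, hY0, hYf⟩ := hsys.growth
  have hxG := hsys.subset hx₀
  have h2 : ∀ᶠ z in 𝓝 x₀, Y z < Y x₀ + 1 :=
    (hY.continuousOn.continuousAt (hsys.domain_G₁.1.mem_nhds hxG)).eventually
      (gt_mem_nhds (by linarith))
  obtain ⟨r, hr, hrs⟩ := Metric.eventually_nhds_iff.1 (h2.and (hsys.domain_G.1.mem_nhds hx₀))
  refine ⟨r, hr, fun y hy => (hrs hy).2, (G₁ ∩ Y ⁻¹' (Icc 0 ((Y x₀ + 1) * Real.exp (C * T)))) ∩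
    closure G, (hYp _ isCompact_Icc).inter_right isClosed_closure, inter_subset_right, ?_⟩
  intro y hy u hu t ht
  have hyG : y ∈ G := (hrs hy).2
  have hmem := hsys.sol_mem hyG hu ht.1
  have hmem₁ := hsys.subset hmem
  refine ⟨⟨hmem₁, hY0 _ hmem₁, ?_⟩, subset_closure hmem⟩
  refine ((hsys.isTrajectory_sol hyG hu).growth_le hsys hY hYf hu ht.1 (EReal.coe_lt_top t)).trans ?_
  have h0 := hY0 _ (hsys.subset hyG)
  have := (hrs hy).1
  gcongr
  · linarith
  · exact ht.2

theorem SystemHyp.exists_lipschitz (hsys : SystemHyp f U G G₁)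
    {K : Set (EuclideanSpace ℝ (Fin n))} (hK : IsCompact K) (hKG : K ⊆ closure G) :
    ∃ L : ℝ, 0 < L ∧ ∀ x ∈ K, ∀ x' ∈ K, ∀ u ∈ U, ‖f x u - f x' u‖ ≤ L * ‖x - x'‖ := by
  obtain ⟨R, hR⟩ := hK.isBounded.subset_closedBall 0
  have hR' : K ⊆ Metric.closedBall 0 (max R 1) :=
    hR.trans (Metric.closedBall_subset_closedBall (le_max_left _ _))
  obtain ⟨L, hL0, hL⟩ := hsys.lipschitz_f (max R 1) (by positivity)
  exact ⟨L, hL0, fun x hx x' hx' => hL x ⟨hR' hx, hKG hx⟩ x' ⟨hR' hx', hKG hx'⟩⟩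

theorem SystemHyp.norm_sol_sub_le (hsys : SystemHyp f U G G₁) (hx₀ : x₀ ∈ G) (hy₀ : y₀ ∈ G)
    (hu : IsControl U u) {L T : ℝ} (hL0 : 0 ≤ L) {K : Set (EuclideanSpace ℝ (Fin n))}
    (hL : ∀ x ∈ K, ∀ x' ∈ K, ∀ u ∈ U, ‖f x u - f x' u‖ ≤ L * ‖x - x'‖)
    (hx : ∀ t ∈ Icc 0 T, sol f G₁ x₀ u t ∈ K) (hy : ∀ t ∈ Icc 0 T, sol f G₁ y₀ u t ∈ K)
    {t : ℝ} (ht : 0 ≤ t) (htT : t < T) :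
    ‖sol f G₁ x₀ u t - sol f G₁ y₀ u t‖ ≤ Real.exp (L * T) * ‖x₀ - y₀‖ := by
  have key := IsTrajectory.norm_sub_le_exp (T := (T : EReal)) hL hu
    (((hsys.isTrajectory_sol hx₀ hu).mono_time le_top).of_mem fun s hs hsT =>
      hx s ⟨hs, by exact_mod_cast hsT.le⟩)
    (((hsys.isTrajectory_sol hy₀ hu).mono_time le_top).of_mem fun s hs hsT =>
      hy s ⟨hs, by exact_mod_cast hsT.le⟩)
    ht (by exact_mod_cast htT) (fun _ _ => rfl)
  refine key.trans ?_
  rw [mul_comm]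
  gcongr

end Solutions

/-! ### The local control Lyapunov function: descending to a level -/

section LocalCLF

variable {n m : ℕ} {f : EuclideanSpace ℝ (Fin n) → EuclideanSpace ℝ (Fin m) →
  EuclideanSpace ℝ (Fin n)} {U : Set (EuclideanSpace ℝ (Fin m))}
  {G G₁ Ω : Set (EuclideanSpace ℝ (Fin n))} {V : EuclideanSpace ℝ (Fin n) → ℝ} {c : ℝ}
  {u v : ℝ → EuclideanSpace ℝ (Fin m)} {x₀ y₀ x z : EuclideanSpace ℝ (Fin n)}

theorem LocalCLFHyp.isCompact_sublevel (hloc : LocalCLFHyp f U G Ω V c) (b : ℝ) :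
    IsCompact (sublevel Ω V b) := by
  convert hloc.proper (Icc 0 b) isCompact_Icc using 1
  ext x
  simp only [sublevel, mem_ofPred_eq, mem_inter_iff, mem_preimage, mem_Icc]
  exact ⟨fun h => ⟨h.1, hloc.nonneg x h.1, h.2⟩, fun h => ⟨h.1, h.2.2⟩⟩

theorem sublevel_mono {a b : ℝ} (hab : a ≤ b) : sublevel Ω V a ⊆ sublevel Ω V b :=
  fun _ hx => ⟨hx.1, hx.2.trans hab⟩

theorem LocalCLFHyp.sublevel_subset (hloc : LocalCLFHyp f U G Ω V c) : sublevel Ω V c ⊆ Ω := by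
  obtain ⟨C, hC, h⟩ := hloc.thickening
  intro x hx
  simpa using h x hx 0 (by simpa using hC)

/-- A slightly larger sublevel set is still inside `Ω`. -/
theorem LocalCLFHyp.exists_level (hloc : LocalCLFHyp f U G Ω V c) :
    ∃ c₁, c < c₁ ∧ sublevel Ω V c₁ ⊆ Ω := by
  -- Otherwise there are points off `Ω` with levels tending to `c`. By compactness a subsequence
  -- converges to a point of `Ω_c`, which lies in the open set `Ω`: a contradiction.
  by_contra! hcon
  have hk : ∀ k : ℕ, ∃ x ∈ sublevel Ω V (c + 1 / ((k : ℝ) + 1)), x ∉ Ω := fun k =>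
    not_subset.1 (hcon _ (lt_add_of_pos_right c Nat.one_div_pos_of_nat))
  choose x hx hxΩ using hk
  have hx1 : ∀ k, x k ∈ sublevel Ω V (c + 1) := fun k => sublevel_mono (by
    have : 1 / ((k : ℝ) + 1) ≤ 1 := by
      rw [div_le_one (by positivity)]; linarith [(k.cast_nonneg : (0 : ℝ) ≤ k)]
    linarith) (hx k)
  obtain ⟨y, hy, φ, hφ, hlim⟩ := (hloc.isCompact_sublevel _).tendsto_subseq hx1
  have hVy : Tendsto (fun k => V (x (φ k))) atTop (𝓝 (V y)) :=
    (hloc.continuous y hy.1).tendsto.comp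
      (tendsto_nhdsWithin_iff.2 ⟨hlim, Eventually.of_forall fun k => (hx1 _).1⟩)
  have hle : V y ≤ c := by
    have h0 : Tendsto (fun k : ℕ => c + 1 / (((φ k : ℕ) : ℝ) + 1)) atTop (𝓝 (c + 0)) :=
      (tendsto_one_div_add_atTop_nhds_zero_nat.comp hφ.tendsto_atTop).const_add c
    rw [add_zero] at h0
    exact le_of_tendsto_of_tendsto' hVy h0 fun k => (hx (φ k)).2
  have hyΩ := hloc.sublevel_subset (⟨hy.1, hle⟩ : y ∈ sublevel Ω V c)
  obtain ⟨k, hk⟩ := (hlim.eventually (hloc.domain_Ω.1.mem_nhds hyΩ)).exists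
  exact hxΩ _ hk

theorem LocalCLFHyp.exists_sublevel_subset_ball (hloc : LocalCLFHyp f U G Ω V c) {ρ : ℝ}
    (hρ : 0 < ρ) : ∃ ε > 0, sublevel Ω V ε ⊆ Metric.ball 0 ρ := by
  have h := (hloc.small.eventually (gt_mem_nhds hρ)).and self_mem_nhdsWithin
  obtain ⟨ε, hε, hε0⟩ := h.exists
  refine ⟨ε, hε0, fun x hx => ?_⟩
  rw [mem_ball_zero_iff]
  refine lt_of_le_of_lt (le_csSup ?_ (mem_image_of_mem _ hx)) hε
  exact ((hloc.isCompact_sublevel ε).image continuous_norm).bddAbove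

theorem LocalCLFHyp.sublevel_mem_nhds (hloc : LocalCLFHyp f U G Ω V c) {b : ℝ}
    (hx : x ∈ Ω) (hb : V x < b) : sublevel Ω V b ∈ 𝓝 x := by
  have hΩ := hloc.domain_Ω.1.mem_nhds hx
  have hV : ∀ᶠ y in 𝓝 x, V y < b :=
    (hloc.continuous.continuousAt (mem_of_superset hΩ subset_closure)).eventually
      (gt_mem_nhds hb)
  filter_upwards [hΩ, hV] with y hy1 hy2
  exact ⟨subset_closure hy1, hy2.le⟩

/-- Over an empty `U` the infimum of Dini derivatives is `⊤`, which no finite decrease rate can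
dominate. -/
theorem LocalCLFHyp.nonempty_U (hloc : LocalCLFHyp f U G Ω V c) : U.Nonempty := by
  obtain ⟨W, -, -, -, hW⟩ := hloc.decrease
  by_contra hU
  rw [not_nonempty_iff_eq_empty] at hU
  have := hW 0 hloc.zero_mem
  simp [hU] at this

/-- First-order expansion of the trajectory of a constant control. -/
theorem SystemHyp.eventually_sol_const (hsys : SystemHyp f U G G₁) (hx : x ∈ G)
    {w : EuclideanSpace ℝ (Fin m)} (hw : w ∈ U) {ε : ℝ} (hε : 0 < ε) :
    ∀ᶠ t in 𝓝[>] (0 : ℝ), ‖sol f G₁ x (fun _ => w) t - x - t • f x w‖ ≤ ε * t := by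
  have hu := isControl_const hw
  have htr := hsys.isTrajectory_sol hx hu
  have hxt := htr.tendsto_right le_rfl (EReal.coe_lt_top 0)
  rw [hsys.sol_zero hx hu] at hxt
  have hfc : ContinuousAt (fun y => f y w) x := by
    have h1 : ContinuousOn (fun y => f y w) G₁ :=
      hsys.continuous_f.comp (by fun_prop : Continuous fun y => (y, w)).continuousOn
        fun y hy => ⟨hy, hw⟩
    exact h1.continuousAt (hsys.domain_G₁.1.mem_nhds (hsys.subset hx))
  have hev := (hfc.tendsto.comp hxt).eventually (Metric.ball_mem_nhds _ hε)
  obtain ⟨δ, hδ, hδs⟩ := (mem_nhdsGT_iff_exists_Ioo_subset' zero_lt_one).1 hev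
  filter_upwards [Ioo_mem_nhdsGT hδ] with t ht
  have ht0 : 0 ≤ t := ht.1.le
  have hii := htr.intervalIntegrable le_rfl ht0 (EReal.coe_lt_top t)
  have h1 : sol f G₁ x (fun _ => w) t - x - t • f x w =
      ∫ s in (0 : ℝ)..t, (f (sol f G₁ x (fun _ => w) s) w - f x w) := by
    rw [intervalIntegral.integral_sub hii intervalIntegrable_const,
      ← htr.sub_eq_integral le_rfl ht0 (EReal.coe_lt_top t), hsys.sol_zero hx hu]
    simp
  rw [h1]
  have h2 := intervalIntegral.norm_integral_le_of_norm_le_const (a := 0) (b := t) (C := ε)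
    (f := fun s => f (sol f G₁ x (fun _ => w) s) w - f x w) fun s hs => by
      rw [uIoc_of_le ht0] at hs
      have : s ∈ Ioo 0 δ := ⟨hs.1, hs.2.trans_lt ht.2⟩
      have := hδs this
      rw [← dist_eq_norm]
      exact le_of_lt this
  simpa [abs_of_nonneg ht0] using h2

/-- One step of decrease, from the lower Dini derivative. -/
theorem exists_decrease_step (hsys : SystemHyp f U G G₁) (hloc : LocalCLFHyp f U G Ω V c)
    (hx : x ∈ Ω) {κ : ℝ} (hκ : (⨅ u ∈ U, lowerDini V x (f x u)) < ((-κ : ℝ) : EReal)) {δ : ℝ}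
    (hδ : 0 < δ) : ∃ w ∈ U, ∃ τ, 0 < τ ∧ τ < δ ∧ V (sol f G₁ x (fun _ => w) τ) ≤ V x - κ * τ := by
  have hxG := hloc.subset_G hx
  simp only [iInf_lt_iff] at hκ
  obtain ⟨w, hw, hlt⟩ := hκ
  obtain ⟨κ', hκ1, hκ2⟩ := EReal.exists_between_coe_real hlt
  have hκ2 : κ' < -κ := by exact_mod_cast hκ2
  obtain ⟨Λ, N, hN, hΛ⟩ := hloc.lipschitz hx
  rw [hloc.domain_Ω.1.nhdsWithin_eq hx] at hN
  -- The trajectory differs from `x + t • y` by at most `2 * ε * t`: one `ε` from its first-order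
  -- expansion, one from `y` being near `f x w`. Multiplied by `Λ`, this stays within the gap
  -- between `κ'` and `-κ`.
  set ε := (-κ - κ') / (2 * (Λ + 1)) with hε
  have hε0 : 0 < ε := by
    have : (0 : ℝ) ≤ Λ := Λ.2
    apply div_pos <;> linarith
  have hfreq : ∃ᶠ p in 𝓝[>] (0 : ℝ) ×ˢ 𝓝 (f x w),
      (((V (x + p.1 • p.2) - V x) / p.1 : ℝ) : EReal) < κ' :=
    frequently_lt_of_liminf_lt (by isBoundedDefault) hκ1
  have hu := isControl_const hw
  have hxt := (hsys.isTrajectory_sol hxG hu).tendsto_right le_rfl (EReal.coe_lt_top 0)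
  rw [hsys.sol_zero hxG hu] at hxt
  have hev1 : ∀ᶠ p in 𝓝[>] (0 : ℝ) ×ˢ 𝓝 (f x w), p.1 ∈ Ioo 0 δ ∧
      ‖sol f G₁ x (fun _ => w) p.1 - x - p.1 • f x w‖ ≤ ε * p.1 ∧
      sol f G₁ x (fun _ => w) p.1 ∈ N :=
    tendsto_fst.eventually ((show ∀ᶠ t in 𝓝[>] (0 : ℝ), t ∈ Ioo 0 δ from Ioo_mem_nhdsGT hδ).and
      ((hsys.eventually_sol_const hxG hw hε0).and (hxt.eventually hN)))
  have hev2 : ∀ᶠ p in 𝓝[>] (0 : ℝ) ×ˢ 𝓝 (f x w), ‖p.2 - f x w‖ < ε := by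
    have : ∀ᶠ y in 𝓝 (f x w), ‖y - f x w‖ < ε := by
      filter_upwards [Metric.ball_mem_nhds _ hε0] with y hy
      rwa [← dist_eq_norm]
    exact tendsto_snd.eventually this
  have hev3 : ∀ᶠ p in 𝓝[>] (0 : ℝ) ×ˢ 𝓝 (f x w), x + p.1 • p.2 ∈ N := by
    have h1 : Tendsto (fun p : ℝ × EuclideanSpace ℝ (Fin n) => x + p.1 • p.2)
        (𝓝 0 ×ˢ 𝓝 (f x w)) (𝓝 x) := by
      rw [← nhds_prod_eq]
      have : Continuous (fun p : ℝ × EuclideanSpace ℝ (Fin n) => x + p.1 • p.2) := by fun_prop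
      simpa using this.tendsto (0, f x w)
    exact (h1.mono_left (prod_mono nhdsWithin_le_nhds le_rfl)).eventually hN
  obtain ⟨⟨t, y⟩, hlt', ⟨⟨ht0, htδ⟩, hsol, hsolN⟩, hy, hyN⟩ :=
    (hfreq.and_eventually (hev1.and (hev2.and hev3))).exists
  simp only at hlt' ht0 htδ hsol hsolN hy hyN
  refine ⟨w, hw, t, ht0, htδ, ?_⟩
  have h1 : V (x + t • y) - V x < κ' * t := by
    have : (V (x + t • y) - V x) / t < κ' := by exact_mod_cast hlt'
    rwa [div_lt_iff₀ ht0] at this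
  have h2 := hΛ.dist_le_mul _ hsolN _ hyN
  rw [Real.dist_eq, dist_eq_norm] at h2
  have h3 : ‖sol f G₁ x (fun _ => w) t - (x + t • y)‖ ≤ 2 * ε * t := by
    have : sol f G₁ x (fun _ => w) t - (x + t • y) =
        (sol f G₁ x (fun _ => w) t - x - t • f x w) - t • (y - f x w) := by
      rw [smul_sub]; abel
    rw [this]
    refine (norm_sub_le _ _).trans ?_
    rw [norm_smul, Real.norm_of_nonneg ht0.le]
    nlinarith
  have hΛ0 : (0 : ℝ) ≤ Λ := Λ.2
  have h4 := (abs_le.1 h2).2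
  have h5 : (Λ : ℝ) * ‖sol f G₁ x (fun _ => w) t - (x + t • y)‖ ≤ (-κ - κ') * t := by
    calc (Λ : ℝ) * ‖sol f G₁ x (fun _ => w) t - (x + t • y)‖ ≤ (Λ + 1) * (2 * ε * t) := by
          gcongr; linarith
      _ = (-κ - κ') * t := by rw [hε]; field_simp
  linarith

theorem SystemHyp.continuousAt_V_sol (hsys : SystemHyp f U G G₁) (hloc : LocalCLFHyp f U G Ω V c)
    (hx₀ : x₀ ∈ G) (hu : IsControl U u) {t : ℝ} (ht : 0 ≤ t) (hmem : sol f G₁ x₀ u t ∈ Ω) :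
    ContinuousWithinAt (fun s => V (sol f G₁ x₀ u s)) (Ici 0) t :=
  ContinuousAt.comp_continuousWithinAt (hloc.continuous.continuousAt
    (mem_of_superset (hloc.domain_Ω.1.mem_nhds hmem) subset_closure))
    (hsys.continuousOn_sol hx₀ hu t ht)

/-- Where the decrease is uniform, a level can be reached in a time controlled by the difference
of the levels. -/
theorem exists_reach_level (hsys : SystemHyp f U G G₁) (hloc : LocalCLFHyp f U G Ω V c)
    {a b κ : ℝ} (hb : sublevel Ω V b ⊆ Ω) (hκ0 : 0 < κ)
    (hκ : ∀ x ∈ sublevel Ω V b, a ≤ V x → (⨅ u ∈ U, lowerDini V x (f x u)) < ((-κ : ℝ) : EReal))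
    (hz : z ∈ Ω) (hza : a ≤ V z) (hzb : V z < b) :
    ∃ u τ, IsControl U u ∧ 0 ≤ τ ∧ κ * τ ≤ V z - a ∧
      (∀ t ∈ Icc 0 τ, sol f G₁ z u t ∈ sublevel Ω V b) ∧ V (sol f G₁ z u τ) = a := by
  have hzG := hloc.subset_G hz
  -- Partial solutions: a control and a time up to which the path stays below level `b`, with the
  -- required average decrease at the final time and without having dropped below `a`. The last two
  -- conditions bound the time by `(V z - a) / κ`.
  let Good : (ℝ → EuclideanSpace ℝ (Fin m)) × ℝ → Prop := fun p =>
    IsControl U p.1 ∧ 0 ≤ p.2 ∧ (∀ t ∈ Icc 0 p.2, sol f G₁ z p.1 t ∈ sublevel Ω V b) ∧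
      V (sol f G₁ z p.1 p.2) ≤ V z - κ * p.2 ∧ a ≤ V (sol f G₁ z p.1 p.2)
  let Ext : (ℝ → EuclideanSpace ℝ (Fin m)) × ℝ → (ℝ → EuclideanSpace ℝ (Fin m)) × ℝ → Prop :=
    fun p q => p.2 ≤ q.2 ∧ ∀ t ∈ Ico 0 p.2, q.1 t = p.1 t
  by_contra hcon
  have hlt : ∀ p, Good p → a < V (sol f G₁ z p.1 p.2) := by
    rintro ⟨u, τ⟩ ⟨h1, h2, h3, h4, h5⟩
    refine lt_of_le_of_ne h5 fun h => hcon ⟨u, τ, h1, h2, ?_, h3, h.symm⟩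
    simp only at h4 h
    linarith
  have hbdd : ∀ p, Good p → p.2 ≤ (V z - a) / κ := by
    rintro ⟨u, τ⟩ ⟨h1, h2, h3, h4, h5⟩
    rw [le_div_iff₀ hκ0]
    simp only at h4 h5 ⊢
    linarith
  have hstep : ∀ p, Good p → ∃ q, Good q ∧ Ext p q ∧ p.2 < q.2 := by
    intro p hp
    have hap := hlt p hp
    obtain ⟨u, τ⟩ := p
    obtain ⟨h1, h2, h3, h4, h5⟩ := hp
    simp only at h1 h2 h3 h4 h5 hap
    set y := sol f G₁ z u τ with hy
    have hyb : y ∈ sublevel Ω V b := h3 τ ⟨h2, le_rfl⟩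
    have hyΩ : y ∈ Ω := hb hyb
    have hyG := hloc.subset_G hyΩ
    have hVyb : V y < b := by nlinarith
    have hnear : ∀ᶠ y' in 𝓝 y, y' ∈ sublevel Ω V b ∧ a ≤ V y' := by
      filter_upwards [hloc.sublevel_mem_nhds hyΩ hVyb, (hloc.continuous.continuousAt (mem_of_superset (hloc.domain_Ω.1.mem_nhds hyΩ)
        subset_closure)).eventually (lt_mem_nhds hap)] with y' hy1 hy2 using ⟨hy1, hy2.le⟩
    obtain ⟨r, hr, hrs⟩ := Metric.eventually_nhds_iff.1 hnear
    -- a uniform bound on the speed keeps short steps in the neighbourhood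
    obtain ⟨r', hr', -, K, hK, hKG, hKs⟩ := hsys.exists_compact_reach hyG 1
    obtain ⟨M, hM0, hM⟩ := hsys.exists_bound hK (hKG.trans hsys.closure_subset)
    have hδ : 0 < min 1 (r / M) := lt_min one_pos (div_pos hr hM0)
    obtain ⟨w, hw, σ, hσ0, hσδ, hσV⟩ := exists_decrease_step hsys hloc hyΩ (hκ y hyb hap.le) hδ
    have hwc := isControl_const hw
    have hσ1 : σ < 1 := hσδ.trans_le (min_le_left _ _)
    have hin : ∀ t ∈ Icc 0 σ, sol f G₁ y (fun _ => w) t ∈ sublevel Ω V b ∧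
        a ≤ V (sol f G₁ y (fun _ => w) t) := by
      intro t ht
      refine hrs ?_
      have h0 := (hsys.isTrajectory_sol hyG hwc).norm_sub_le (M := M) le_rfl ht.1
        (EReal.coe_lt_top t) fun s hs => hM _ (hKs y (Metric.mem_ball_self hr') _ hwc s
          ⟨hs.1, hs.2.trans (ht.2.trans hσ1.le)⟩) _ hw
      rw [hsys.sol_zero hyG hwc] at h0
      rw [dist_eq_norm]
      refine h0.trans_lt ?_
      have : t < r / M := ht.2.trans_lt (hσδ.trans_le (min_le_right _ _))
      rw [lt_div_iff₀ hM0] at this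
      linarith
    have hcat : ∀ t, 0 ≤ t → sol f G₁ z (concat u τ fun _ => w) (τ + t) = sol f G₁ y (fun _ => w) t :=
      fun t ht => hsys.sol_concat_add hzG h1 hwc h2 ht
    refine ⟨(concat u τ fun _ => w, τ + σ), ⟨h1.concat hwc h2, by simp only; linarith, ?_, ?_, ?_⟩,
      ⟨by simp only; linarith, fun t ht => by simp [concat, ht.2]⟩, by simp only; linarith⟩
    · intro t ht
      rcases le_total t τ with h | h
      · simp only
        rw [hsys.sol_concat_of_le hzG h1 hwc ht.1 h]
        exact h3 t ⟨ht.1, h⟩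
      · have := hcat (t - τ) (sub_nonneg.2 h)
        rw [add_sub_cancel] at this
        simp only
        rw [this]
        exact (hin (t - τ) ⟨sub_nonneg.2 h, by linarith [ht.2]⟩).1
    · simp only
      rw [hcat σ hσ0.le]
      nlinarith
    · simp only
      rw [hcat σ hσ0.le]
      exact (hin σ ⟨hσ0.le, le_rfl⟩).2
  -- greedy choice of prolongations
  let D : (ℝ → EuclideanSpace ℝ (Fin m)) × ℝ → Set ℝ := fun p =>
    Prod.snd '' {q | Good q ∧ Ext p q}
  have hDb : ∀ p, BddAbove (D p) := fun p => ⟨_, by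
    rintro _ ⟨q, hq, rfl⟩
    exact hbdd q hq.1⟩
  -- Each prolongation covers more than half of the distance to the supremum of attainable times, so
  -- that the limit of the sequence is maximal without appeal to Zorn's lemma.
  have hnext : ∀ p, ∃ q, Good p → Good q ∧ Ext p q ∧ (p.2 + sSup (D p)) / 2 < q.2 := by
    intro p
    by_cases hp : Good p
    · obtain ⟨q, hq, hpq, hlt'⟩ := hstep p hp
      have h1 : q.2 ≤ sSup (D p) := le_csSup (hDb p) ⟨q, ⟨hq, hpq⟩, rfl⟩
      have h2 : (p.2 + sSup (D p)) / 2 < sSup (D p) := by linarith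
      obtain ⟨_, ⟨q', hq', rfl⟩, hlt''⟩ := exists_lt_of_lt_csSup
        (show (D p).Nonempty from ⟨_, q, ⟨hq, hpq⟩, rfl⟩) h2
      exact ⟨q', fun _ => ⟨hq'.1, hq'.2, hlt''⟩⟩
    · exact ⟨p, fun h => absurd h hp⟩
  choose next hnext using hnext
  obtain ⟨w₀, hw₀⟩ := hloc.nonempty_U
  have hw₀c := isControl_const hw₀
  let p : ℕ → (ℝ → EuclideanSpace ℝ (Fin m)) × ℝ := fun k => next^[k] (fun _ => w₀, 0)
  have hpS : ∀ k, p (k + 1) = next (p k) := fun k => Function.iterate_succ_apply' _ _ _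
  have hp0 : Good (p 0) := by
    refine ⟨hw₀c, le_rfl, fun t ht => ?_, ?_, ?_⟩
    · have : t = 0 := le_antisymm ht.2 ht.1
      subst this
      simp only [p, Function.iterate_zero, id]
      rw [hsys.sol_zero hzG hw₀c]
      exact ⟨subset_closure hz, hzb.le⟩
    · simp [p, hsys.sol_zero hzG hw₀c]
    · simp [p, hsys.sol_zero hzG hw₀c, hza]
  have hpG : ∀ k, Good (p k) := by
    intro k
    induction k with
    | zero => exact hp0
    | succ k ih => rw [hpS]; exact (hnext _ ih).1
  have hpE : ∀ k, Ext (p k) (p (k + 1)) := fun k => by rw [hpS]; exact (hnext _ (hpG k)).2.1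
  have hpm : Monotone fun k => (p k).2 := monotone_nat_of_le_succ fun k => (hpE k).1
  have hpb : BddAbove (range fun k => (p k).2) := ⟨_, by
    rintro _ ⟨k, rfl⟩
    exact hbdd _ (hpG k)⟩
  have hlim := tendsto_atTop_ciSup hpm hpb
  set τ := ⨆ k, (p k).2 with hτ
  have hle : ∀ k, (p k).2 ≤ τ := fun k => le_ciSup hpb k
  have hτ0 : 0 ≤ τ := (hpG 0).2.1.trans (hle 0)
  obtain ⟨us, hus, husk, -⟩ := exists_control_of_seq (fun k => (hpG k).1) hpm
    (fun k => (hpE k).2) hw₀c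
  have hsolk : ∀ k t, 0 ≤ t → t ≤ (p k).2 → sol f G₁ z us t = sol f G₁ z (p k).1 t :=
    fun k t ht htk => hsys.sol_congr hzG hus (hpG k).1 (husk k) ht htk
  have hsoltend : Tendsto (fun k => sol f G₁ z us (p k).2) atTop (𝓝 (sol f G₁ z us τ)) :=
    (hsys.continuousOn_sol hzG hus τ hτ0).tendsto.comp
      (tendsto_nhdsWithin_iff.2 ⟨hlim, Eventually.of_forall fun k => (hpG k).2.1⟩)
  have hsolp : ∀ k, sol f G₁ z us (p k).2 = sol f G₁ z (p k).1 (p k).2 := fun k =>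
    hsolk k _ (hpG k).2.1 le_rfl
  have hτb : sol f G₁ z us τ ∈ sublevel Ω V b := by
    refine (hloc.isCompact_sublevel b).isClosed.mem_of_tendsto hsoltend
      (Eventually.of_forall fun k => ?_)
    rw [hsolp]
    exact (hpG k).2.2.1 _ ⟨(hpG k).2.1, le_rfl⟩
  have hVtend : Tendsto (fun k => V (sol f G₁ z us (p k).2)) atTop (𝓝 (V (sol f G₁ z us τ))) :=
    (hsys.continuousAt_V_sol hloc hzG hus hτ0 (hb hτb)).tendsto.comp
      (tendsto_nhdsWithin_iff.2 ⟨hlim, Eventually.of_forall fun k => (hpG k).2.1⟩)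
  have hgood : Good (us, τ) := by
    refine ⟨hus, hτ0, fun t ht => ?_, ?_, ?_⟩
    · rcases ht.2.eq_or_lt with h | h
      · simp only at h ⊢
        rw [h]
        exact hτb
      · obtain ⟨k, hk⟩ := exists_lt_of_lt_ciSup h
        simp only
        rw [hsolk k t ht.1 hk.le]
        exact (hpG k).2.2.1 t ⟨ht.1, hk.le⟩
    · refine le_of_tendsto_of_tendsto' hVtend ((hlim.const_mul κ).const_sub (V z)) fun k => ?_
      rw [hsolp]
      exact (hpG k).2.2.2.1
    · refine ge_of_tendsto' hVtend fun k => ?_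
      rw [hsolp]
      exact (hpG k).2.2.2.2
  obtain ⟨q, hq, hqE, hqlt⟩ := hstep _ hgood
  simp only at hqlt
  have hqk : ∀ k, Ext (p k) q := fun k => ⟨(hle k).trans hqE.1, fun t ht => by
    rw [hqE.2 t ⟨ht.1, ht.2.trans_le (hle k)⟩]; exact husk k t ht⟩
  -- The prolongation `q` of the limit also prolongs every `p k`, so it competed in each greedy
  -- choice. Letting `k` tend to infinity gives `(τ + q.2) / 2 ≤ τ`, against `τ < q.2`.
  have hfin : ∀ k, ((p k).2 + q.2) / 2 ≤ τ := by
    intro k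
    have h1 := (hnext _ (hpG k)).2.2
    rw [← hpS] at h1
    have h2 : q.2 ≤ sSup (D (p k)) := le_csSup (hDb _) ⟨q, ⟨hq, hqk k⟩, rfl⟩
    linarith [hle (k + 1)]
  have := le_of_tendsto' ((hlim.add_const q.2).div_const 2) hfin
  linarith

/-- Uniform decrease between two levels. -/
theorem LocalCLFHyp.exists_rate (hloc : LocalCLFHyp f U G Ω V c) {a b : ℝ} (ha : 0 < a)
    (hb : sublevel Ω V b ⊆ Ω) : ∃ κ > 0, ∀ x ∈ sublevel Ω V b, a ≤ V x →
      (⨅ u ∈ U, lowerDini V x (f x u)) < ((-κ : ℝ) : EReal) := by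
  obtain ⟨W, hWc, -, hWp, hW⟩ := hloc.decrease
  have hcpt : IsCompact {x | x ∈ sublevel Ω V b ∧ a ≤ V x} := by
    refine (hloc.isCompact_sublevel b).of_isClosed_subset ?_ fun x hx => hx.1
    have := (hloc.continuous.mono fun x (hx : x ∈ sublevel Ω V b) => hx.1).preimage_isClosed_of_isClosed
      (hloc.isCompact_sublevel b).isClosed (isClosed_Ici (a := a))
    exact this
  rcases eq_empty_or_nonempty {x | x ∈ sublevel Ω V b ∧ a ≤ V x} with h | h
  · exact ⟨1, one_pos, fun x hx hxa => absurd (show x ∈ {x | x ∈ sublevel Ω V b ∧ a ≤ V x} from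
      ⟨hx, hxa⟩) (by simp [h])⟩
  · obtain ⟨y, hy, hmin⟩ := hcpt.exists_isMinOn h (hWc.mono fun x hx => hb hx.1)
    have hy0 : y ≠ 0 := by
      rintro rfl
      have := hy.2
      rw [hloc.posDef.1] at this
      linarith
    have hWy := hWp.2 y (hb hy.1) hy0
    refine ⟨W y / 2, by positivity, fun x hx hxa => (hW x (hb hx)).trans_lt ?_⟩
    have : W y ≤ W x := hmin ⟨hx, hxa⟩
    exact_mod_cast (by linarith : -W x < -(W y / 2))

end LocalCLF

/-! ### An equilibrium at the origin and local null-controllability -/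

section Stabilization

variable {n m : ℕ} {f : EuclideanSpace ℝ (Fin n) → EuclideanSpace ℝ (Fin m) →
  EuclideanSpace ℝ (Fin n)} {U : Set (EuclideanSpace ℝ (Fin m))}
  {G G₁ Ω : Set (EuclideanSpace ℝ (Fin n))} {V : EuclideanSpace ℝ (Fin n) → ℝ} {c : ℝ}
  {u v : ℝ → EuclideanSpace ℝ (Fin m)} {x₀ y₀ x z : EuclideanSpace ℝ (Fin n)}

/-- By convexity of the velocity sets, the origin is an equilibrium for some control value. -/
theorem exists_equilibrium (hsys : SystemHyp f U G G₁) (hconv : ConvexVelocities f U G)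
    (hloc : LocalCLFHyp f U G Ω V c) : ∃ w ∈ U, f 0 w = 0 := by
  by_contra hcon
  have h0 : (0 : EuclideanSpace ℝ (Fin n)) ∉ f 0 '' U := by
    rintro ⟨w, hw, h⟩
    exact hcon ⟨w, hw, h⟩
  have h0G := hsys.zero_mem
  have hfc : IsCompact (f 0 '' U) := hsys.compact_U.image_of_continuousOn
    (hsys.continuous_f.comp (by fun_prop : Continuous fun w => ((0 : EuclideanSpace ℝ (Fin n)), w)).continuousOn
      fun w hw => ⟨hsys.subset h0G, hw⟩)
  -- If `0` is not a velocity at the origin, a linear form is bounded below by `δ > 0` on the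
  -- compact convex set of velocities there. By the Lipschitz bound it is then nondecreasing along
  -- trajectories near the origin. A state with `φ > 0` could not be steered towards `0`, as the
  -- Lyapunov function allows.
  obtain ⟨φ, δ, hφ0, hφ⟩ := geometric_hahn_banach_point_closed (hconv 0 (subset_closure h0G))
    hfc.isClosed h0
  rw [map_zero] at hφ0
  -- near the origin the linear form increases along all trajectories
  obtain ⟨r₀, hr₀, hball⟩ := Metric.isOpen_iff.1 hsys.domain_G.1 0 h0G
  obtain ⟨L, hL0, hL⟩ := hsys.exists_lipschitz (K := Metric.closedBall 0 (r₀ / 2))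
    (isCompact_closedBall _ _) ((Metric.closedBall_subset_ball (by linarith)).trans
      (hball.trans subset_closure))
  set ρ := min (r₀ / 2) (δ / (L * (‖φ‖ + 1))) with hρ
  have hρ0 : 0 < ρ := by positivity
  have hpos : ∀ y, ‖y‖ ≤ ρ → ∀ w ∈ U, 0 ≤ φ (f y w) := by
    intro y hy w hw
    have h1 := hL 0 (Metric.mem_closedBall_self (by positivity)) y
      (by rw [mem_closedBall_zero_iff]; exact hy.trans (min_le_left _ _)) w hw
    rw [zero_sub, norm_neg] at h1
    have h2 := hφ _ (mem_image_of_mem _ hw)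
    have h3 : φ (f 0 w) - φ (f y w) ≤ ‖φ‖ * (L * ‖y‖) := by
      rw [← map_sub]
      exact (le_abs_self _).trans ((φ.le_opNorm _).trans (by gcongr))
    have h4 : ‖φ‖ * (L * ‖y‖) ≤ δ := by
      have : ‖y‖ ≤ δ / (L * (‖φ‖ + 1)) := hy.trans (min_le_right _ _)
      rw [le_div_iff₀ (by positivity)] at this
      nlinarith [norm_nonneg φ, norm_nonneg y, mul_nonneg hL0.le (norm_nonneg y)]
    linarith
  obtain ⟨ε, hε0, hε⟩ := hloc.exists_sublevel_subset_ball hρ0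
  obtain ⟨c₁, hc₁, hΩ⟩ := hloc.exists_level
  set b := min ε c₁ with hb
  have hb0 : 0 < b := lt_min hε0 (hloc.level_pos.trans hc₁)
  have hbΩ : sublevel Ω V b ⊆ Ω := (sublevel_mono (min_le_right _ _)).trans hΩ
  obtain ⟨w, hw⟩ := hloc.nonempty_U
  -- an initial state on the positive side
  set q := f 0 w with hq
  have hφq : 0 < φ q := hφ0.trans (hφ _ (mem_image_of_mem _ hw))
  have hV0 : V 0 < b := by rw [hloc.posDef.1]; exact hb0
  have hev : ∀ᶠ t in 𝓝[>] (0 : ℝ), t • q ∈ Ω ∧ V (t • q) < b := by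
    have hcont : Tendsto (fun t : ℝ => t • q) (𝓝[>] 0) (𝓝 0) := by
      have : Continuous fun t : ℝ => t • q := by fun_prop
      simpa using (this.tendsto 0).mono_left nhdsWithin_le_nhds
    have hΩ0 := hloc.domain_Ω.1.mem_nhds hloc.zero_mem
    have hVev : ∀ᶠ y in 𝓝 0, V y < b :=
      (hloc.continuous.continuousAt (mem_of_superset hΩ0 subset_closure)).eventually
        (gt_mem_nhds hV0)
    exact (hcont.eventually_mem hΩ0).and (hcont.eventually hVev)
  obtain ⟨t, ⟨hzΩ, hzb⟩, ht⟩ := (hev.and self_mem_nhdsWithin).exists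
  set z := t • q with hz
  have hφz : 0 < φ z := by rw [hz, map_smul]; exact mul_pos ht hφq
  have hz0 : z ≠ 0 := by rintro h; rw [h, map_zero] at hφz; exact lt_irrefl _ hφz
  have hVz : 0 < V z := hloc.posDef.2 z (subset_closure hzΩ) hz0
  -- On the ball of this radius `φ` is smaller than `φ z`, so reaching it contradicts monotonicity.
  obtain ⟨ε', hε'0, hε'⟩ := hloc.exists_sublevel_subset_ball (show 0 < φ z / (‖φ‖ + 1) by positivity)
  set a := min ε' (V z) with ha
  have ha0 : 0 < a := lt_min hε'0 hVz
  obtain ⟨κ, hκ0, hκ⟩ := hloc.exists_rate ha0 hbΩ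
  obtain ⟨u, τ, hu, hτ0, -, hin, hVa⟩ := exists_reach_level hsys hloc hbΩ hκ0 hκ hzΩ
    (min_le_right _ _) hzb
  have hzG := hloc.subset_G hzΩ
  have htr := hsys.isTrajectory_sol hzG hu
  have hinc : φ z ≤ φ (sol f G₁ z u τ) := by
    have h1 := htr.sub_eq_integral le_rfl hτ0 (EReal.coe_lt_top τ)
    rw [hsys.sol_zero hzG hu] at h1
    have h2 := φ.intervalIntegral_comp_comm (htr.intervalIntegrable le_rfl hτ0 (EReal.coe_lt_top τ))
    rw [← h1, map_sub] at h2
    have h3 : 0 ≤ ∫ s in (0 : ℝ)..τ, φ (f (sol f G₁ z u s) (u s)) :=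
      intervalIntegral.integral_nonneg hτ0 fun s hs => hpos _ (by
        have := hε (sublevel_mono (min_le_left _ _) (hin s hs))
        rw [mem_ball_zero_iff] at this
        exact this.le) _ (hu.2 s hs.1)
    linarith
  have hend : sol f G₁ z u τ ∈ sublevel Ω V ε' :=
    ⟨(hin τ ⟨hτ0, le_rfl⟩).1, by rw [hVa]; exact min_le_left _ _⟩
  have hsmall := hε' hend
  rw [mem_ball_zero_iff, lt_div_iff₀ (by positivity)] at hsmall
  have h5 := (le_abs_self _).trans (φ.le_opNorm (sol f G₁ z u τ))
  nlinarith [norm_nonneg (sol f G₁ z u τ)]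

theorem SystemHyp.sol_equilibrium (hsys : SystemHyp f U G G₁) {w : EuclideanSpace ℝ (Fin m)}
    (hw : w ∈ U) (hf : f 0 w = 0) {t : ℝ} (ht : 0 ≤ t) : sol f G₁ 0 (fun _ => w) t = 0 := by
  refine (hsys.eq_sol (x := fun _ => 0) hsys.zero_mem (isControl_const hw) ?_ ht).symm
  intro s _ _
  refine ⟨hsys.subset hsys.zero_mem, ?_, ?_⟩ <;> simp [hf]

theorem mem_nullControllable_iff (hsys : SystemHyp f U G G₁) :
    x₀ ∈ nullControllable f U G G₁ ↔ x₀ ∈ G ∧ ∃ u, IsControl U u ∧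
      Tendsto (sol f G₁ x₀ u) atTop (𝓝 0) := by
  refine and_congr_right fun hx₀ => ⟨?_, ?_⟩
  · rintro ⟨u, x, hu, hx, hlim⟩
    refine ⟨u, hu, (tendsto_zero_iff_norm_tendsto_zero.2 hlim).congr' ?_⟩
    filter_upwards [eventually_ge_atTop 0] with t ht
    exact hsys.eq_sol hx₀ hu hx ht
  · rintro ⟨u, hu, hlim⟩
    exact ⟨u, _, hu, hsys.isTrajectory_sol hx₀ hu, tendsto_zero_iff_norm_tendsto_zero.1 hlim⟩

/-- Local asymptotic controllability from the control Lyapunov function. -/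
theorem mem_nullControllable_of_level (hsys : SystemHyp f U G G₁) (hconv : ConvexVelocities f U G)
    (hloc : LocalCLFHyp f U G Ω V c) {c₁ : ℝ} (hΩ : sublevel Ω V c₁ ⊆ Ω) (hc₁ : 0 < c₁)
    (hz : z ∈ Ω) (hVz : V z < c₁) : z ∈ nullControllable f U G G₁ := by
  have hzG := hloc.subset_G hz
  obtain ⟨w, hw, hfw⟩ := exists_equilibrium hsys hconv hloc
  have hwc := isControl_const hw
  -- Stage `k` starts strictly below level `a k`, stays in that sublevel set and ends strictly below
  -- `a (k + 1)`. The decrease rate degenerates at the origin, so each stage uses its own.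
  let a : ℕ → ℝ := fun k => c₁ / 2 ^ k
  have ha0 : ∀ k, 0 < a k := fun k => by positivity
  have haS : ∀ k, a (k + 1) = a k / 2 := fun k => by simp only [a, pow_succ]; field_simp
  have ham : ∀ k j, k ≤ j → a j ≤ a k := fun k j hkj => by
    simp only [a]; gcongr; norm_num
  have hal : Tendsto a atTop (𝓝 0) := by
    have := (tendsto_pow_atTop_nhds_zero_of_lt_one (r := (1 / 2 : ℝ)) (by norm_num)
      (by norm_num)).const_mul c₁
    rw [mul_zero] at this
    refine this.congr fun k => ?_
    simp only [a]
    rw [one_div, inv_pow]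
    rfl
  have haΩ : ∀ k, sublevel Ω V (a k) ⊆ Ω := fun k =>
    (sublevel_mono (by simpa [a] using ham 0 k (Nat.zero_le _))).trans hΩ
  let P : ℕ → (ℝ → EuclideanSpace ℝ (Fin m)) × ℝ → Prop := fun k p =>
    IsControl U p.1 ∧ 0 ≤ p.2 ∧ sol f G₁ z p.1 p.2 ∈ Ω ∧ V (sol f G₁ z p.1 p.2) < a k
  let R : ℕ → (ℝ → EuclideanSpace ℝ (Fin m)) × ℝ → (ℝ → EuclideanSpace ℝ (Fin m)) × ℝ → Prop :=
    fun k p q => p.2 ≤ q.2 ∧ (∀ t ∈ Ico 0 p.2, q.1 t = p.1 t) ∧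
      ∀ t ∈ Icc p.2 q.2, sol f G₁ z q.1 t ∈ sublevel Ω V (a k)
  have hstep : ∀ k p, ∃ q, P k p → P (k + 1) q ∧ R k p q := by
    rintro k ⟨u, τ⟩
    by_cases hP : P k (u, τ)
    swap
    · exact ⟨(u, τ), fun h => absurd h hP⟩
    obtain ⟨hu, hτ, hΩy, hVy⟩ := hP
    simp only at hu hτ hΩy hVy
    set y := sol f G₁ z u τ with hy
    rcases lt_or_ge (V y) (a (k + 1)) with hlt | hge
    · refine ⟨(u, τ), fun _ => ⟨⟨hu, hτ, hΩy, hlt⟩, le_rfl, fun _ _ => rfl, fun t ht => ?_⟩⟩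
      have : t = τ := le_antisymm ht.2 ht.1
      subst this
      exact ⟨subset_closure hΩy, hVy.le⟩
    -- The stage aims at level `a (k + 2)`, strictly below `a (k + 1)`, because the next stage needs
    -- a strict inequality to start.
    · obtain ⟨κ, hκ0, hκ⟩ := hloc.exists_rate (ha0 (k + 2)) (haΩ k)
      have hS2 := haS (k + 1)
      obtain ⟨u', σ, hu', hσ0, -, hin, hVa⟩ := exists_reach_level hsys hloc (haΩ k) hκ0 hκ hΩy
        (by linarith [ha0 (k + 1)]) hVy
      have hcat : ∀ t, 0 ≤ t → sol f G₁ z (concat u τ u') (τ + t) = sol f G₁ y u' t :=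
        fun t ht => hsys.sol_concat_add hzG hu hu' hτ ht
      refine ⟨(concat u τ u', τ + σ), fun _ => ⟨⟨hu.concat hu' hτ, by positivity, ?_, ?_⟩,
        by simpa using hσ0, fun t ht => by simp [concat, ht.2], fun t ht => ?_⟩⟩
      · simp only
        rw [hcat σ hσ0]
        exact haΩ k (hin σ ⟨hσ0, le_rfl⟩)
      · simp only
        rw [hcat σ hσ0, hVa]
        linarith [ha0 (k + 1)]
      · simp only at ht ⊢
        have := hcat (t - τ) (sub_nonneg.2 ht.1)
        rw [add_sub_cancel] at this
        rw [this]
        exact hin _ ⟨sub_nonneg.2 ht.1, by linarith [ht.2]⟩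
  choose next hnext using hstep
  let p : ℕ → (ℝ → EuclideanSpace ℝ (Fin m)) × ℝ := fun k =>
    Nat.rec (fun _ => w, 0) (fun k q => next k q) k
  have hP : ∀ k, P k (p k) := by
    intro k
    induction k with
    | zero =>
      refine ⟨hwc, le_rfl, ?_, ?_⟩
      · change sol f G₁ z (fun _ => w) 0 ∈ Ω
        rwa [hsys.sol_zero hzG hwc]
      · change V (sol f G₁ z (fun _ => w) 0) < c₁ / 2 ^ 0
        rw [hsys.sol_zero hzG hwc]
        simpa using hVz
    | succ k ih => exact (hnext k _ ih).1
  have hR : ∀ k, R k (p k) (p (k + 1)) := fun k => (hnext k _ (hP k)).2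
  have hpm : Monotone fun k => (p k).2 := monotone_nat_of_le_succ fun k => (hR k).1
  obtain ⟨us, hus, husk, hust⟩ := exists_control_of_seq (fun k => (hP k).1) hpm
    (fun k => (hR k).2.1) hwc
  have hsolk : ∀ k t, 0 ≤ t → t ≤ (p k).2 → sol f G₁ z us t = sol f G₁ z (p k).1 t :=
    fun k t ht htk => hsys.sol_congr hzG hus (hP k).1 (husk k) ht htk
  have hstage : ∀ k, ∀ t ∈ Icc (p k).2 (p (k + 1)).2, sol f G₁ z us t ∈ sublevel Ω V (a k) :=
    fun k t ht => by
      rw [hsolk (k + 1) t ((hP k).2.1.trans ht.1) ht.2]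
      exact (hR k).2.2 t ht
  have hsmall : ∀ ρ > 0, ∃ k, ∀ j ≥ k, sublevel Ω V (a j) ⊆ Metric.ball 0 ρ := by
    intro ρ hρ
    obtain ⟨ε, hε0, hε⟩ := hloc.exists_sublevel_subset_ball hρ
    obtain ⟨k, hk⟩ := (hal.eventually (gt_mem_nhds hε0)).exists
    exact ⟨k, fun j hj => (sublevel_mono ((ham k j hj).trans hk.le)).trans hε⟩
  refine (mem_nullControllable_iff hsys).2 ⟨hzG, us, hus, ?_⟩
  -- If the stage times accumulate at a finite `τ`, the state at `τ` is the origin by continuity,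
  -- and the equilibrium control holds it there. Otherwise every late time belongs to some late
  -- stage.
  by_cases hb : BddAbove (range fun k => (p k).2)
  · have hlim := tendsto_atTop_ciSup hpm hb
    set τ := ⨆ k, (p k).2 with hτ
    have hle : ∀ k, (p k).2 ≤ τ := fun k => le_ciSup hb k
    have hτ0 : 0 ≤ τ := (hP 0).2.1.trans (hle 0)
    have hsoltend : Tendsto (fun k => sol f G₁ z us (p k).2) atTop (𝓝 (sol f G₁ z us τ)) :=
      (hsys.continuousOn_sol hzG hus τ hτ0).tendsto.comp
        (tendsto_nhdsWithin_iff.2 ⟨hlim, Eventually.of_forall fun k => (hP k).2.1⟩)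
    have hzero : Tendsto (fun k => sol f G₁ z us (p k).2) atTop (𝓝 0) := by
      rw [Metric.tendsto_atTop]
      intro ρ hρ
      obtain ⟨k, hk⟩ := hsmall ρ hρ
      exact ⟨k, fun j hj => hk j hj (hstage j _ ⟨le_rfl, (hR j).1⟩)⟩
    have hτz := tendsto_nhds_unique hsoltend hzero
    refine tendsto_const_nhds.congr' ?_
    filter_upwards [eventually_ge_atTop τ] with t ht
    have h1 := hsys.sol_add hzG hus hτ0 (sub_nonneg.2 ht)
    rw [add_sub_cancel, hτz] at h1
    rw [h1, hsys.sol_congr hsys.zero_mem (hus.shift hτ0) hwc (t := t - τ) (fun s hs => ?_)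
      (sub_nonneg.2 ht) le_rfl, hsys.sol_equilibrium hw hfw (sub_nonneg.2 ht)]
    exact hust _ fun k => (hle k).trans (by linarith [hs.1])
  · rw [Metric.tendsto_atTop]
    intro ρ hρ
    obtain ⟨k, hk⟩ := hsmall ρ hρ
    refine ⟨(p k).2, fun t ht => ?_⟩
    have hex : ∃ j, t < (p j).2 := by
      by_contra! h
      exact hb ⟨t, by rintro _ ⟨j, rfl⟩; exact h j⟩
    classical
    have hspec := Nat.find_spec hex
    have hkf : k < Nat.find hex := by
      by_contra! h
      exact absurd (hspec.trans_le (hpm h)) (not_lt.2 ht)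
    obtain ⟨j, hj⟩ : ∃ j, Nat.find hex = j + 1 := Nat.exists_eq_succ_of_ne_zero (by omega)
    rw [hj] at hspec hkf
    have hjt : (p j).2 ≤ t := not_lt.1 (Nat.find_min hex (by omega))
    exact hk j (by omega) (hstage j t ⟨hjt, hspec.le⟩)

end Stabilization

/-! ### The exit-time value: dynamic programming and local comparison -/

section Value

variable {n m : ℕ} {f : EuclideanSpace ℝ (Fin n) → EuclideanSpace ℝ (Fin m) →
  EuclideanSpace ℝ (Fin n)} {U : Set (EuclideanSpace ℝ (Fin m))}
  {G G₁ Ω K : Set (EuclideanSpace ℝ (Fin n))} {V : EuclideanSpace ℝ (Fin n) → ℝ} {c : ℝ}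
  {g : EuclideanSpace ℝ (Fin n) → EuclideanSpace ℝ (Fin m) → ℝ}
  {u v : ℝ → EuclideanSpace ℝ (Fin m)} {x₀ y₀ x y z : EuclideanSpace ℝ (Fin n)}

variable (f G₁ g) in
/-- The running cost of a control up to time `T`. -/
def runCost (x₀ : EuclideanSpace ℝ (Fin n)) (u : ℝ → EuclideanSpace ℝ (Fin m)) (T : ℝ) : ℝ≥0∞ :=
  ∫⁻ t in Ioc 0 T, ENNReal.ofReal (g (sol f G₁ x₀ u t) (u t))

theorem SystemHyp.runCost_congr (hsys : SystemHyp f U G G₁) (hx : x ∈ G) (hu : IsControl U u)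
    (hv : IsControl U v) {T : ℝ} (huv : ∀ t ∈ Ico 0 T, u t = v t) :
    runCost f G₁ g x u T = runCost f G₁ g x v T := by
  unfold runCost
  rw [← restrict_Ioo_eq_restrict_Ioc]
  refine setLIntegral_congr_fun measurableSet_Ioo fun t ht => ?_
  rw [huv t ⟨ht.1.le, ht.2⟩, hsys.sol_congr hx hu hv huv ht.1.le ht.2.le]

theorem SystemHyp.runCost_add (hsys : SystemHyp f U G G₁) (hx : x ∈ G) (hu : IsControl U u)
    {τ T : ℝ} (hτ : 0 ≤ τ) (hT : 0 ≤ T) :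
    runCost f G₁ g x u (τ + T) = runCost f G₁ g x u τ +
      runCost f G₁ g (sol f G₁ x u τ) (fun s => u (τ + s)) T := by
  have h1 : Ioc 0 (τ + T) = Ioc 0 τ ∪ Ioc τ (τ + T) :=
    (Ioc_union_Ioc_eq_Ioc hτ (by linarith)).symm
  unfold runCost
  rw [h1, lintegral_union measurableSet_Ioc (Set.disjoint_left.2 fun t h h' => not_lt.2 h.2 h'.1)]
  congr 1
  have hpre : (fun s => τ + s) ⁻¹' Ioc τ (τ + T) = Ioc 0 T := by ext s; simp
  rw [← (measurePreserving_add_left (volume : Measure ℝ) τ).setLIntegral_comp_preimage_emb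
    (measurableEmbedding_addLeft τ), hpre]
  refine setLIntegral_congr_fun measurableSet_Ioc fun t ht => ?_
  simp only
  rw [hsys.sol_add hx hu hτ ht.1.le]

theorem SystemHyp.runCost_concat (hsys : SystemHyp f U G G₁) (hx : x ∈ G) (hu : IsControl U u)
    (hv : IsControl U v) {τ T : ℝ} (hτ : 0 ≤ τ) (hT : 0 ≤ T) :
    runCost f G₁ g x (concat u τ v) (τ + T) = runCost f G₁ g x u τ +
      runCost f G₁ g (sol f G₁ x u τ) v T := by
  have hw := hu.concat hv hτ
  rw [hsys.runCost_add hx hw hτ hT, hsys.runCost_congr hx hw hu (fun t ht => by simp [concat, ht.2]),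
    hsys.sol_concat_of_le hx hu hv hτ le_rfl]
  congr 1
  exact hsys.runCost_congr (hsys.sol_mem hx hu hτ) (hw.shift hτ) hv fun t ht => by simp [concat, ht.1]

theorem runCost_mono {T T' : ℝ} (h : T ≤ T') : runCost f G₁ g x u T ≤ runCost f G₁ g x u T' :=
  lintegral_mono_set (Ioc_subset_Ioc_right h)

theorem runCost_le {M T : ℝ} (hT : 0 ≤ T)
    (hM : ∀ t ∈ Icc 0 T, g (sol f G₁ x u t) (u t) ≤ M) :
    runCost f G₁ g x u T ≤ ENNReal.ofReal (M * T) := by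
  refine (setLIntegral_mono' measurableSet_Ioc (g := fun _ => ENNReal.ofReal M) fun t ht =>
    ENNReal.ofReal_le_ofReal (hM t (Ioc_subset_Icc_self ht))).trans ?_
  simp [ENNReal.ofReal_mul' hT]

/-- The endpoint is left out of the hypothesis: at the hitting time the state is already in the
target, while a positive lower bound on the cost is assumed only off its interior. One instant does
not affect the integral. -/
theorem le_runCost {M T : ℝ} (hT : 0 ≤ T)
    (hM : ∀ t ∈ Ico 0 T, M ≤ g (sol f G₁ x u t) (u t)) :
    ENNReal.ofReal (M * T) ≤ runCost f G₁ g x u T := by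
  unfold runCost
  rw [← restrict_Ioo_eq_restrict_Ioc]
  refine le_trans ?_ (setLIntegral_mono' measurableSet_Ioo (f := fun _ => ENNReal.ofReal M)
    fun t ht => ENNReal.ofReal_le_ofReal (hM t (Ioo_subset_Ico_self ht)))
  simp [ENNReal.ofReal_mul' hT]

theorem runCost_le_add {δ T : ℝ} (hT : 0 ≤ T) (hδ : ∀ t ∈ Icc 0 T,
    g (sol f G₁ y u t) (u t) ≤ g (sol f G₁ x u t) (u t) + δ) :
    runCost f G₁ g y u T ≤ runCost f G₁ g x u T + ENNReal.ofReal (δ * T) := by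
  unfold runCost
  refine (setLIntegral_mono' measurableSet_Ioc (g := fun t =>
    ENNReal.ofReal (g (sol f G₁ x u t) (u t)) + ENNReal.ofReal δ) fun t ht =>
    (ENNReal.ofReal_le_ofReal (hδ t (Ioc_subset_Icc_self ht))).trans ENNReal.ofReal_add_le).trans ?_
  rw [lintegral_add_right _ measurable_const]
  simp [ENNReal.ofReal_mul' hT]

/-- The time `T` need not be the first hitting time, since stopping at the first one costs no more.
-/
theorem SystemHyp.exitValue_le (hsys : SystemHyp f U G G₁) (hx : x ∈ G) (hu : IsControl U u)
    {T : ℝ} (hT : 0 ≤ T) (hmem : sol f G₁ x u T ∈ K) :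
    exitValue f U G₁ c g K x ≤ runCost f G₁ g x u T + ENNReal.ofReal c := by
  have hle : hitTime K (sol f G₁ x u) ≤ ENNReal.ofReal T := iInf₂_le T ⟨hT, hmem⟩
  have h : exitValue f U G₁ c g K x ≤
      runCost f G₁ g x u (hitTime K (sol f G₁ x u)).toReal + ENNReal.ofReal c :=
    iInf_le_of_le u <| iInf_le_of_le (sol f G₁ x u) <| iInf_le_of_le
      ⟨hu, hsys.isTrajectory_sol hx hu, hle.trans_lt ENNReal.ofReal_lt_top⟩ le_rfl
  refine h.trans ?_
  gcongr
  refine runCost_mono ?_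
  have := ENNReal.toReal_mono ENNReal.ofReal_ne_top hle
  rwa [ENNReal.toReal_ofReal hT] at this

/-- Closedness of the target and continuity of the path make the hitting time attained, so a
near-optimal control comes with an actual first time in `K`. -/
theorem SystemHyp.exists_of_exitValue_lt (hsys : SystemHyp f U G G₁) (hK : IsClosed K) (hx : x ∈ G)
    {a : ℝ≥0∞} (ha : exitValue f U G₁ c g K x < a) :
    ∃ u T, IsControl U u ∧ 0 ≤ T ∧ sol f G₁ x u T ∈ K ∧ (∀ t ∈ Ico 0 T, sol f G₁ x u t ∉ K) ∧
      runCost f G₁ g x u T + ENNReal.ofReal c < a := by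
  unfold exitValue at ha
  simp only [iInf_lt_iff] at ha
  obtain ⟨u, y, ⟨hu, hy, hhit⟩, hlt⟩ := ha
  have heq : ∀ t, 0 ≤ t → y t = sol f G₁ x u t := fun t ht => hsys.eq_sol hx hu hy ht
  set S := {T : ℝ | 0 ≤ T ∧ sol f G₁ x u T ∈ K} with hS
  have hSne : S.Nonempty := by
    by_contra hne
    rw [not_nonempty_iff_eq_empty] at hne
    refine hhit.ne (iInf₂_eq_top.2 ?_)
    rintro T ⟨hT, hTK⟩
    rw [heq T hT] at hTK
    exact absurd (show T ∈ S from ⟨hT, hTK⟩) (by simp [hne])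
  have hScl : IsClosed S := by
    have := (hsys.continuousOn_sol hx hu).preimage_isClosed_of_isClosed isClosed_Ici hK
    exact this
  have hSb : BddBelow S := ⟨0, fun T hT => hT.1⟩
  have hmem := hScl.csInf_mem hSne hSb
  have hhe : hitTime K y = ENNReal.ofReal (sInf S) := by
    refine le_antisymm (iInf₂_le _ ⟨hmem.1, by rw [heq _ hmem.1]; exact hmem.2⟩)
      (le_iInf₂ fun T hT => ?_)
    · refine ENNReal.ofReal_le_ofReal (csInf_le hSb ⟨hT.1, ?_⟩)
      rw [← heq _ hT.1]; exact hT.2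
  refine ⟨u, sInf S, hu, hmem.1, hmem.2, fun t ht htK => ?_, ?_⟩
  · exact absurd (csInf_le hSb ⟨ht.1, htK⟩) (not_le.2 ht.2)
  · rw [hhe, ENNReal.toReal_ofReal hmem.1] at hlt
    refine lt_of_eq_of_lt ?_ hlt
    congr 1
    refine setLIntegral_congr_fun measurableSet_Ioc fun t ht => ?_
    rw [heq t ht.1.le]

theorem ofReal_le_exitValue : ENNReal.ofReal c ≤ exitValue f U G₁ c g K x :=
  le_iInf fun _ => le_iInf fun _ => le_iInf fun _ => le_add_self

/-- Half of the dynamic programming principle. -/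
theorem SystemHyp.exitValue_le_add (hsys : SystemHyp f U G G₁) (hK : IsClosed K) (hx : x ∈ G)
    (hu : IsControl U u) {τ : ℝ} (hτ : 0 ≤ τ) :
    exitValue f U G₁ c g K x ≤ runCost f G₁ g x u τ + exitValue f U G₁ c g K (sol f G₁ x u τ) := by
  refine ENNReal.le_of_forall_pos_le_add fun ε hε hlt => ?_
  have hfin : exitValue f U G₁ c g K (sol f G₁ x u τ) ≠ ⊤ := (lt_of_le_of_lt le_add_self hlt).ne
  have hyG := hsys.sol_mem hx hu hτ
  obtain ⟨v, T, hv, hT, hTK, -, hvlt⟩ := hsys.exists_of_exitValue_lt hK hyG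
    (ENNReal.lt_add_right hfin (by simpa using hε.ne' : (ε : ℝ≥0∞) ≠ 0))
  have := hsys.exitValue_le (c := c) (g := g) (K := K) hx (hu.concat hv hτ) (T := τ + T) (by positivity)
    (by rwa [hsys.sol_concat_add hx hu hv hτ hT])
  rw [hsys.runCost_concat hx hu hv hτ hT] at this
  refine this.trans ?_
  rw [add_assoc, add_assoc]
  gcongr

/-- The other half of the dynamic programming principle, along a near-optimal control. -/
theorem SystemHyp.add_exitValue_le (hsys : SystemHyp f U G G₁) (hx : x ∈ G)
    (hu : IsControl U u) {τ T : ℝ} (hτ : 0 ≤ τ) (hτT : τ ≤ T) (hmem : sol f G₁ x u T ∈ K) :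
    runCost f G₁ g x u τ + exitValue f U G₁ c g K (sol f G₁ x u τ) ≤
      runCost f G₁ g x u T + ENNReal.ofReal c := by
  have h1 := hsys.runCost_add (g := g) hx hu hτ (sub_nonneg.2 hτT)
  have h2 := hsys.sol_add hx hu hτ (sub_nonneg.2 hτT)
  rw [add_sub_cancel] at h1 h2
  rw [h1, add_assoc]
  gcongr
  exact hsys.exitValue_le (hsys.sol_mem hx hu hτ) (hu.shift hτ) (sub_nonneg.2 hτT) (h2 ▸ hmem)

theorem SystemHyp.exitValue_eq_of_mem (hsys : SystemHyp f U G G₁) (hU : U.Nonempty) (hx : x ∈ G)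
    (hxK : x ∈ K) : exitValue f U G₁ c g K x = ENNReal.ofReal c := by
  obtain ⟨w, hw⟩ := hU
  refine le_antisymm ?_ ofReal_le_exitValue
  have := hsys.exitValue_le (c := c) (g := g) (K := K) hx (isControl_const hw) (T := 0) le_rfl
    (by rwa [hsys.sol_zero hx (isControl_const hw)])
  simpa [runCost] using this

theorem RunningCostHyp.exists_bound (hsys : SystemHyp f U G G₁) (hcost : RunningCostHyp U G g K)
    {A : Set (EuclideanSpace ℝ (Fin n))} (hA : IsCompact A) (hAG : A ⊆ closure G) :
    ∃ M : ℝ, 0 < M ∧ ∀ x ∈ A, ∀ u ∈ U, g x u ≤ M := by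
  obtain ⟨M, hM⟩ := (hA.prod hsys.compact_U).exists_bound_of_continuousOn
    (hcost.continuous.mono (prod_mono_left hAG))
  exact ⟨max M 1, by positivity, fun x hx u hu =>
    (le_abs_self _).trans ((hM (x, u) ⟨hx, hu⟩).trans (le_max_left _ _))⟩

theorem RunningCostHyp.exists_lipschitz (hcost : RunningCostHyp U G g K)
    {A : Set (EuclideanSpace ℝ (Fin n))} (hA : IsCompact A) (hAG : A ⊆ closure G) :
    ∃ L : ℝ, 0 < L ∧ ∀ x ∈ A, ∀ x' ∈ A, ∀ u ∈ U, |g x u - g x' u| ≤ L * ‖x - x'‖ := by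
  obtain ⟨R, hR⟩ := hA.isBounded.subset_closedBall 0
  have hR' : A ⊆ Metric.closedBall 0 (max R 1) :=
    hR.trans (Metric.closedBall_subset_closedBall (le_max_left _ _))
  obtain ⟨L, hL0, hL⟩ := hcost.lipschitz (max R 1) (by positivity)
  exact ⟨L, hL0, fun x hx x' hx' => hL x ⟨hR' hx, hAG hx⟩ x' ⟨hR' hx', hAG hx'⟩⟩

theorem SystemHyp.runCost_lt_top (hsys : SystemHyp f U G G₁) (hcost : RunningCostHyp U G g K)
    (hx : x ∈ G) (hu : IsControl U u) {T : ℝ} (hT : 0 ≤ T) : runCost f G₁ g x u T < ⊤ := by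
  obtain ⟨r, hr, -, A, hA, hAG, hAs⟩ := hsys.exists_compact_reach hx T
  obtain ⟨M, -, hM⟩ := hcost.exists_bound hsys hA hAG
  exact (runCost_le hT fun t ht => hM _ (hAs x (Metric.mem_ball_self hr) u hu t ht) _
    (hu.2 t ht.1)).trans_lt ENNReal.ofReal_lt_top

theorem mem_nullControllable_of_sol (hsys : SystemHyp f U G G₁) (hx : x ∈ G) (hu : IsControl U u)
    {T : ℝ} (hT : 0 ≤ T) (hmem : sol f G₁ x u T ∈ nullControllable f U G G₁) :
    x ∈ nullControllable f U G G₁ := by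
  obtain ⟨-, v, hv, hlim⟩ := (mem_nullControllable_iff hsys).1 hmem
  refine (mem_nullControllable_iff hsys).2 ⟨hx, _, hu.concat hv hT, ?_⟩
  refine (hlim.comp (tendsto_atTop_add_const_right atTop (-T) tendsto_id)).congr' ?_
  filter_upwards [eventually_ge_atTop T] with t ht
  have := hsys.sol_concat_add hx hu hv hT (sub_nonneg.2 ht)
  rw [add_sub_cancel] at this
  simp [this, sub_eq_add_neg]

/-- Near the target, the exit-time value exceeds the terminal cost at most linearly. -/
theorem exists_near_target (hsys : SystemHyp f U G G₁) (hconv : ConvexVelocities f U G)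
    (hloc : LocalCLFHyp f U G Ω V c) (hcost : RunningCostHyp U G g (sublevel Ω V c)) :
    ∃ r > 0, ∃ L : ℝ, 0 ≤ L ∧ ∀ k ∈ sublevel Ω V c, ∀ z, ‖z - k‖ ≤ r →
      z ∈ nullControllable f U G G₁ ∧
      exitValue f U G₁ c g (sublevel Ω V c) z ≤ ENNReal.ofReal (L * ‖z - k‖) + ENNReal.ofReal c := by
  obtain ⟨c₁, hc₁, hΩ⟩ := hloc.exists_level
  have hc0 := hloc.level_pos
  have hN : IsOpen {z | z ∈ Ω ∧ V z < c₁} := by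
    have := (hloc.continuous.mono subset_closure).isOpen_inter_preimage hloc.domain_Ω.1
      (isOpen_Iio (a := c₁))
    exact this
  obtain ⟨r, hr, hrN⟩ := (hloc.isCompact_sublevel c).exists_cthickening_subset_open hN
    fun x hx => ⟨hloc.sublevel_subset hx, hx.2.trans_lt hc₁⟩
  have hcpt := hloc.isCompact_sublevel c₁
  obtain ⟨Λ, hΛ⟩ := (hloc.lipschitz.mono hΩ).exists_lipschitzOnWith_of_compact hcpt
  obtain ⟨M, hM0, hM⟩ := hcost.exists_bound hsys hcpt
    ((hΩ.trans hloc.subset_G).trans subset_closure)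
  obtain ⟨κ, hκ0, hκ⟩ := hloc.exists_rate hc0 hΩ
  -- Reaching level `c` from `z` takes time at most `(V z - c) / κ ≤ (Λ / κ) * ‖z - k‖`, at a cost
  -- of at most `M` per unit of time.
  refine ⟨r, hr, M * (Λ / κ), by positivity, fun k hk z hz => ?_⟩
  obtain ⟨hzΩ, hzc⟩ := hrN (Metric.mem_cthickening_of_dist_le z k r _ hk (by rwa [dist_eq_norm]))
  refine ⟨mem_nullControllable_of_level hsys hconv hloc hΩ (hc0.trans hc₁) hzΩ hzc, ?_⟩
  have hzG := hloc.subset_G hzΩ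
  rcases le_or_gt (V z) c with hle | hgt
  · rw [hsys.exitValue_eq_of_mem hloc.nonempty_U hzG (⟨subset_closure hzΩ, hle⟩ : z ∈ sublevel Ω V c)]
    exact le_add_self
  · obtain ⟨u, T, hu, hT, hκT, hin, hVT⟩ := exists_reach_level hsys hloc hΩ hκ0 hκ hzΩ hgt.le hzc
    refine (hsys.exitValue_le hzG hu hT (⟨(hin T ⟨hT, le_rfl⟩).1, hVT.le⟩ : _ ∈ sublevel Ω V c)).trans ?_
    gcongr
    refine (runCost_le hT fun t ht => hM _ (hin t ht) _ (hu.2 t ht.1)).trans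
      (ENNReal.ofReal_le_ofReal ?_)
    have h1 := hΛ.dist_le_mul z ⟨subset_closure hzΩ, hzc.le⟩ k (sublevel_mono hc₁.le hk)
    rw [Real.dist_eq, dist_eq_norm] at h1
    have h2 := (abs_le.1 h1).2
    rw [mul_assoc]
    gcongr
    rw [div_mul_eq_mul_div, le_div_iff₀ hκ0]
    linarith [hk.2]

/-- Local comparison of the exit-time values at two points, one of them with a bounded value. -/
theorem exists_local_comparison (hsys : SystemHyp f U G G₁) (hconv : ConvexVelocities f U G)
    (hloc : LocalCLFHyp f U G Ω V c) (hcost : RunningCostHyp U G g (sublevel Ω V c))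
    (hx₀ : x₀ ∈ G) (M : ℝ) :
    ∃ r > 0, ∃ Λ : ℝ, 0 ≤ Λ ∧ ∀ x ∈ Metric.ball x₀ r, ∀ y ∈ Metric.ball x₀ r,
      exitValue f U G₁ c g (sublevel Ω V c) x ≤ ENNReal.ofReal M →
      y ∈ nullControllable f U G G₁ ∧ exitValue f U G₁ c g (sublevel Ω V c) y ≤
        exitValue f U G₁ c g (sublevel Ω V c) x + ENNReal.ofReal (Λ * ‖x - y‖) := by
  wlog hM0 : 0 ≤ M generalizing M
  · obtain ⟨r, hr, Λ, hΛ, h⟩ := this 0 le_rfl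
    refine ⟨r, hr, Λ, hΛ, fun x hx y hy hxM => h x hx y hy (hxM.trans ?_)⟩
    exact ENNReal.ofReal_le_ofReal (not_le.1 hM0).le
  have hK := (hloc.isCompact_sublevel c).isClosed
  obtain ⟨C, hC0, hC⟩ := hcost.inf_pos
  obtain ⟨r₀, hr₀, L', hL', hnear⟩ := exists_near_target hsys hconv hloc hcost
  -- Off the target the cost is at least `C` per unit of time, so a control within `1` of a value at
  -- most `M` arrives by time `T₁`. The reachable set is taken up to `T₁ + 1` because the Grönwall
  -- estimate is used strictly before its horizon.
  set T₁ := (M + 1) / C with hT₁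
  obtain ⟨r₁, hr₁, hrG, A, hA, hAG, hAs⟩ := hsys.exists_compact_reach hx₀ (T₁ + 1)
  obtain ⟨L, hL0, hL⟩ := hsys.exists_lipschitz hA hAG
  obtain ⟨Lg, hLg0, hLg⟩ := hcost.exists_lipschitz hA hAG
  set E := Real.exp (L * (T₁ + 1)) with hE
  have hE0 : 0 < E := Real.exp_pos _
  have hT₁0 : 0 ≤ T₁ := by positivity
  -- With this radius the endpoint of the trajectory from `y` is within `r₀` of the target. The
  -- constant adds the difference in running costs up to `T₁` and the cost of the final descent into
  -- the target.
  refine ⟨min r₁ (r₀ / (2 * E)), by positivity, Lg * E * T₁ + L' * E, by positivity, ?_⟩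
  intro x hx y hy hxM
  have hx₁ := Metric.ball_subset_ball (min_le_left _ _) hx
  have hy₁ := Metric.ball_subset_ball (min_le_left _ _) hy
  have hxG := hrG hx₁
  have hyG := hrG hy₁
  have hxy : E * ‖x - y‖ ≤ r₀ := by
    have h1 := Metric.mem_ball.1 (Metric.ball_subset_ball (min_le_right _ _) hx)
    have h2 := Metric.mem_ball'.1 (Metric.ball_subset_ball (min_le_right _ _) hy)
    have h3 := dist_triangle x x₀ y
    rw [dist_eq_norm x y] at h3
    have h4 : ‖x - y‖ ≤ r₀ / (2 * E) + r₀ / (2 * E) := by linarith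
    calc E * ‖x - y‖ ≤ E * (r₀ / (2 * E) + r₀ / (2 * E)) := by gcongr
      _ = r₀ := by field_simp; ring
  have hxtop : exitValue f U G₁ c g (sublevel Ω V c) x ≠ ⊤ :=
    (hxM.trans_lt ENNReal.ofReal_lt_top).ne
  have main : ∀ ε : ℝ≥0, 0 < ε → ε ≤ 1 → y ∈ nullControllable f U G G₁ ∧
      exitValue f U G₁ c g (sublevel Ω V c) y ≤ exitValue f U G₁ c g (sublevel Ω V c) x +
        ENNReal.ofReal ((Lg * E * T₁ + L' * E) * ‖x - y‖) + ε := by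
    intro ε hε hε1
    obtain ⟨u, T, hu, hT, hTK, hTn, hlt⟩ := hsys.exists_of_exitValue_lt hK hxG
      (ENNReal.lt_add_right hxtop (by simpa using hε.ne' : (ε : ℝ≥0∞) ≠ 0))
    have hTT : T ≤ T₁ := by
      have h1 := le_runCost (g := g) (x := x) (f := f) (G₁ := G₁) (u := u) (M := C) hT fun t ht =>
        hC _ ⟨hsys.sol_mem hxG hu ht.1, fun h => hTn t ht (interior_subset h)⟩ _ (hu.2 t ht.1)
      have h2 : ENNReal.ofReal (C * T) ≤ ENNReal.ofReal (M + 1) := by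
        rw [ENNReal.ofReal_add hM0 zero_le_one, ENNReal.ofReal_one]
        refine (h1.trans (le_self_add.trans hlt.le)).trans (add_le_add hxM ?_)
        exact_mod_cast hε1
      rw [ENNReal.ofReal_le_ofReal_iff (by positivity)] at h2
      rw [hT₁, le_div_iff₀ hC0]
      linarith
    have hAx : ∀ t ∈ Icc 0 (T₁ + 1), sol f G₁ x u t ∈ A := hAs x hx₁ u hu
    have hAy : ∀ t ∈ Icc 0 (T₁ + 1), sol f G₁ y u t ∈ A := hAs y hy₁ u hu
    have hdiff : ∀ t ∈ Icc 0 T, ‖sol f G₁ x u t - sol f G₁ y u t‖ ≤ E * ‖x - y‖ := fun t ht =>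
      hsys.norm_sol_sub_le hxG hyG hu hL0.le hL hAx hAy ht.1 (by linarith [ht.2])
    have hdT : ‖sol f G₁ y u T - sol f G₁ x u T‖ ≤ E * ‖x - y‖ := by
      rw [norm_sub_rev]; exact hdiff T ⟨hT, le_rfl⟩
    obtain ⟨hN1, hN2⟩ := hnear _ hTK _ (hdT.trans hxy)
    refine ⟨mem_nullControllable_of_sol hsys hyG hu hT hN1, ?_⟩
    have hrc : runCost f G₁ g y u T ≤ runCost f G₁ g x u T +
        ENNReal.ofReal (Lg * (E * ‖x - y‖) * T) := by
      refine runCost_le_add hT fun t ht => ?_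
      have htI : t ∈ Icc 0 (T₁ + 1) := ⟨ht.1, by linarith [ht.2]⟩
      have h1 := hLg _ (hAx t htI) _ (hAy t htI) _ (hu.2 t ht.1)
      have h2 := (abs_le.1 h1).1
      have h3 : Lg * ‖sol f G₁ x u t - sol f G₁ y u t‖ ≤ Lg * (E * ‖x - y‖) := by
        gcongr; exact hdiff t ht
      linarith
    have hsum : ENNReal.ofReal (Lg * (E * ‖x - y‖) * T) + ENNReal.ofReal (L' * (E * ‖x - y‖)) ≤
        ENNReal.ofReal ((Lg * E * T₁ + L' * E) * ‖x - y‖) := by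
      rw [← ENNReal.ofReal_add (by positivity) (by positivity)]
      refine ENNReal.ofReal_le_ofReal ?_
      have : Lg * (E * ‖x - y‖) * T ≤ Lg * (E * ‖x - y‖) * T₁ := by gcongr
      linarith
    calc exitValue f U G₁ c g (sublevel Ω V c) y
        ≤ runCost f G₁ g y u T + exitValue f U G₁ c g (sublevel Ω V c) (sol f G₁ y u T) :=
          hsys.exitValue_le_add hK hyG hu hT
      _ ≤ (runCost f G₁ g x u T + ENNReal.ofReal (Lg * (E * ‖x - y‖) * T)) +
          (ENNReal.ofReal (L' * (E * ‖x - y‖)) + ENNReal.ofReal c) := by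
          refine add_le_add hrc (hN2.trans ?_)
          gcongr
      _ = (runCost f G₁ g x u T + ENNReal.ofReal c) + (ENNReal.ofReal (Lg * (E * ‖x - y‖) * T) +
          ENNReal.ofReal (L' * (E * ‖x - y‖))) := by ring
      _ ≤ (exitValue f U G₁ c g (sublevel Ω V c) x + ε) +
          ENNReal.ofReal ((Lg * E * T₁ + L' * E) * ‖x - y‖) := add_le_add hlt.le hsum
      _ = _ := by ring
  refine ⟨(main 1 one_pos le_rfl).1, ENNReal.le_of_forall_pos_le_add fun ε hε _ => ?_⟩
  refine (main (min ε 1) (lt_min hε one_pos) (min_le_right _ _)).2.trans ?_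
  gcongr
  exact min_le_left _ _

end Value

/-! ### Regularity, blow-up and the Hamilton–Jacobi–Bellman equation -/

section Regularity

variable {n m : ℕ} {f : EuclideanSpace ℝ (Fin n) → EuclideanSpace ℝ (Fin m) →
  EuclideanSpace ℝ (Fin n)} {U : Set (EuclideanSpace ℝ (Fin m))}
  {G G₁ Ω K : Set (EuclideanSpace ℝ (Fin n))} {V : EuclideanSpace ℝ (Fin n) → ℝ} {c : ℝ}
  {g : EuclideanSpace ℝ (Fin n) → EuclideanSpace ℝ (Fin m) → ℝ}
  {u v : ℝ → EuclideanSpace ℝ (Fin m)} {x₀ y₀ x y z : EuclideanSpace ℝ (Fin n)}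

/-- A trajectory tending to the origin enters `Ω_c`, a neighbourhood of the origin, in finite time,
and the cost over a bounded time is finite. -/
theorem exitValue_lt_top (hsys : SystemHyp f U G G₁) (hloc : LocalCLFHyp f U G Ω V c)
    (hcost : RunningCostHyp U G g (sublevel Ω V c)) (hx : x ∈ nullControllable f U G G₁) :
    exitValue f U G₁ c g (sublevel Ω V c) x < ⊤ := by
  obtain ⟨hxG, u, hu, hlim⟩ := (mem_nullControllable_iff hsys).1 hx
  have h0 : sublevel Ω V c ∈ 𝓝 (0 : EuclideanSpace ℝ (Fin n)) :=
    hloc.sublevel_mem_nhds hloc.zero_mem (by rw [hloc.posDef.1]; exact hloc.level_pos)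
  obtain ⟨T, hTK, hT⟩ := ((hlim.eventually_mem h0).and (eventually_ge_atTop 0)).exists
  exact (hsys.exitValue_le hxG hu hT hTK).trans_lt
    (ENNReal.add_lt_top.2 ⟨hsys.runCost_lt_top hcost hxG hu hT, ENNReal.ofReal_lt_top⟩)

/-- The exit-time value is locally Lipschitz, and `nullControllable` is a neighbourhood of each of
its points. -/
theorem exists_exitValue_lipschitz (hsys : SystemHyp f U G G₁) (hconv : ConvexVelocities f U G)
    (hloc : LocalCLFHyp f U G Ω V c) (hcost : RunningCostHyp U G g (sublevel Ω V c))
    (hx₀ : x₀ ∈ nullControllable f U G G₁) :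
    ∃ r > 0, ∃ Λ : ℝ, 0 ≤ Λ ∧ Metric.ball x₀ r ⊆ nullControllable f U G G₁ ∧
      ∀ x ∈ Metric.ball x₀ r, ∀ y ∈ Metric.ball x₀ r,
        |(exitValue f U G₁ c g (sublevel Ω V c) x).toReal -
          (exitValue f U G₁ c g (sublevel Ω V c) y).toReal| ≤ Λ * ‖x - y‖ := by
  set W := exitValue f U G₁ c g (sublevel Ω V c) with hW
  have hx₀t := exitValue_lt_top hsys hloc hcost hx₀
  set M := (W x₀).toReal with hM
  have hWM : W x₀ = ENNReal.ofReal M := (ENNReal.ofReal_toReal hx₀t.ne).symm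
  have hM0 : 0 ≤ M := ENNReal.toReal_nonneg
  obtain ⟨r, hr, Λ, hΛ, h⟩ := exists_local_comparison hsys hconv hloc hcost hx₀.1 (M + 1)
  -- On this smaller ball the comparison with `x₀` raises the value by at most `1`. All values there
  -- are thus at most `M + 1`, and the comparison applies in both directions.
  have hsub : Metric.ball x₀ (min r (1 / (Λ + 1))) ⊆ Metric.ball x₀ r :=
    Metric.ball_subset_ball (min_le_left _ _)
  have hstart := fun y (hy : y ∈ Metric.ball x₀ (min r (1 / (Λ + 1)))) =>
    h x₀ (Metric.mem_ball_self hr) y (hsub hy) (by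
      change W x₀ ≤ _
      rw [hWM]; exact ENNReal.ofReal_le_ofReal (by linarith))
  have hbd : ∀ y ∈ Metric.ball x₀ (min r (1 / (Λ + 1))), W y ≤ ENNReal.ofReal (M + 1) := by
    intro y hy
    refine (hstart y hy).2.trans ?_
    change W x₀ + _ ≤ _
    rw [hWM, ← ENNReal.ofReal_add hM0 (by positivity)]
    refine ENNReal.ofReal_le_ofReal ?_
    have h1 := Metric.mem_ball'.1 (Metric.ball_subset_ball (min_le_right _ _) hy)
    rw [dist_eq_norm, lt_div_iff₀ (by positivity)] at h1
    nlinarith [norm_nonneg (x₀ - y)]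
  have hone : ∀ x ∈ Metric.ball x₀ (min r (1 / (Λ + 1))),
      ∀ y ∈ Metric.ball x₀ (min r (1 / (Λ + 1))), (W y).toReal ≤ (W x).toReal + Λ * ‖x - y‖ := by
    intro x hx y hy
    have hxt : W x ≠ ⊤ := ((hbd x hx).trans_lt ENNReal.ofReal_lt_top).ne
    have h1 := (h x (hsub hx) y (hsub hy) (hbd x hx)).2
    have h2 := ENNReal.toReal_mono (ENNReal.add_ne_top.2 ⟨hxt, ENNReal.ofReal_ne_top⟩) h1
    rwa [ENNReal.toReal_add hxt ENNReal.ofReal_ne_top, ENNReal.toReal_ofReal (by positivity)] at h2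
  refine ⟨_, lt_min hr (by positivity), Λ, hΛ, fun y hy => (hstart y hy).1, fun x hx y hy => ?_⟩
  have h1 := hone x hx y hy
  have h2 := hone y hy x hx
  rw [norm_sub_rev] at h2
  exact abs_le.2 ⟨by linarith, by linarith⟩

theorem isOpen_nullControllable (hsys : SystemHyp f U G G₁) (hconv : ConvexVelocities f U G)
    (hloc : LocalCLFHyp f U G Ω V c) (hcost : RunningCostHyp U G g (sublevel Ω V c)) :
    IsOpen (nullControllable f U G G₁) :=
  Metric.isOpen_iff.2 fun _ hx =>
    let ⟨r, hr, _, _, hsub, _⟩ := exists_exitValue_lipschitz hsys hconv hloc hcost hx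
    ⟨r, hr, hsub⟩

variable (Ω V c) in
open Classical in
/-- The difference of the glued function and the exit-time value. -/
def gluing (x : EuclideanSpace ℝ (Fin n)) : ℝ := if x ∈ sublevel Ω V c then V x - c else 0

theorem LocalCLFHyp.gluing_eq_min (hx : x ∈ Ω) : gluing Ω V c x = min (V x - c) 0 := by
  unfold gluing
  split_ifs with h
  · rw [min_eq_left (by linarith [h.2])]
  · have : c < V x := by
      by_contra! hle
      exact h ⟨subset_closure hx, hle⟩
    rw [min_eq_right (by linarith)]

/-- In `Ω` the correction is a minimum of Lipschitz functions; off `Ω` one is away from the compact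
set `Ω_c`, and it vanishes nearby. -/
theorem LocalCLFHyp.exists_gluing_lipschitz (hloc : LocalCLFHyp f U G Ω V c)
    (x₀ : EuclideanSpace ℝ (Fin n)) :
    ∃ r > 0, ∃ Λ : ℝ, 0 ≤ Λ ∧ ∀ x ∈ Metric.ball x₀ r, ∀ y ∈ Metric.ball x₀ r,
      |gluing Ω V c x - gluing Ω V c y| ≤ Λ * ‖x - y‖ := by
  by_cases hx₀ : x₀ ∈ Ω
  · obtain ⟨Λ, N, hN, hΛ⟩ := hloc.lipschitz hx₀
    rw [hloc.domain_Ω.1.nhdsWithin_eq hx₀] at hN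
    obtain ⟨r, hr, hrs⟩ := Metric.mem_nhds_iff.1 (inter_mem hN (hloc.domain_Ω.1.mem_nhds hx₀))
    refine ⟨r, hr, Λ, Λ.2, fun x hx y hy => ?_⟩
    have h1 := hΛ.dist_le_mul x (hrs hx).1 y (hrs hy).1
    rw [Real.dist_eq, dist_eq_norm] at h1
    rw [gluing_eq_min (hrs hx).2, gluing_eq_min (hrs hy).2]
    refine (abs_min_sub_min_le_max _ _ _ _).trans ?_
    rw [sub_self, abs_zero, sub_sub_sub_cancel_right, max_eq_left (abs_nonneg _)]
    exact h1
  · have hK : x₀ ∈ (sublevel Ω V c)ᶜ := fun h => hx₀ (hloc.sublevel_subset h)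
    obtain ⟨r, hr, hrs⟩ := Metric.isOpen_iff.1 (hloc.isCompact_sublevel c).isClosed.isOpen_compl _ hK
    refine ⟨r, hr, 0, le_rfl, fun x hx y hy => ?_⟩
    simp [gluing, show x ∉ sublevel Ω V c from hrs hx, show y ∉ sublevel Ω V c from hrs hy]

theorem LocalCLFHyp.gluing_mem (hloc : LocalCLFHyp f U G Ω V c) :
    -c ≤ gluing Ω V c x ∧ gluing Ω V c x ≤ 0 := by
  have := hloc.level_pos
  unfold gluing
  split_ifs with h
  · have := hloc.nonneg x h.1
    have := h.2
    constructor <;> linarith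
  · constructor <;> linarith

/-- The exit value equals `c` on the target. Splitting the glued function into this sum avoids a
case analysis at the boundary of `Ω_c` in the Lipschitz estimate. -/
theorem gluedValue_eq_add (hsys : SystemHyp f U G G₁) (hloc : LocalCLFHyp f U G Ω V c)
    (hx : x ∈ G) : (gluedValue f U G₁ Ω V c g x).toReal =
      (exitValue f U G₁ c g (sublevel Ω V c) x).toReal + gluing Ω V c x := by
  unfold gluedValue gluing
  split_ifs with h
  · rw [hsys.exitValue_eq_of_mem hloc.nonempty_U hx h, ENNReal.toReal_ofReal (hloc.nonneg x h.1),
      ENNReal.toReal_ofReal hloc.level_pos.le]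
    ring
  · rw [add_zero]

theorem gluedValue_ne_top (hsys : SystemHyp f U G G₁) (hloc : LocalCLFHyp f U G Ω V c)
    (hcost : RunningCostHyp U G g (sublevel Ω V c)) (hx : x ∈ nullControllable f U G G₁) :
    gluedValue f U G₁ Ω V c g x ≠ ⊤ := by
  unfold gluedValue
  split_ifs with h
  · exact ENNReal.ofReal_ne_top
  · exact (exitValue_lt_top hsys hloc hcost hx).ne

theorem locallyLipschitzOn_gluedValue (hsys : SystemHyp f U G G₁) (hconv : ConvexVelocities f U G)
    (hloc : LocalCLFHyp f U G Ω V c) (hcost : RunningCostHyp U G g (sublevel Ω V c)) :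
    LocallyLipschitzOn (nullControllable f U G G₁)
      (fun x => (gluedValue f U G₁ Ω V c g x).toReal) := by
  intro x₀ hx₀
  obtain ⟨r, hr, Λ, hΛ, hsub, h⟩ := exists_exitValue_lipschitz hsys hconv hloc hcost hx₀
  obtain ⟨r', hr', Λ', hΛ', h'⟩ := hloc.exists_gluing_lipschitz x₀
  refine ⟨(Λ + Λ').toNNReal, Metric.ball x₀ (min r r'),
    mem_nhdsWithin_of_mem_nhds (Metric.ball_mem_nhds _ (lt_min hr hr')), ?_⟩
  refine LipschitzOnWith.of_dist_le_mul fun x hx y hy => ?_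
  have hx1 := Metric.ball_subset_ball (min_le_left _ _) hx
  have hy1 := Metric.ball_subset_ball (min_le_left _ _) hy
  have h1 := abs_le.1 (h x hx1 y hy1)
  have h2 := abs_le.1 (h' x (Metric.ball_subset_ball (min_le_right _ _) hx) y
    (Metric.ball_subset_ball (min_le_right _ _) hy))
  rw [Real.dist_eq, dist_eq_norm, gluedValue_eq_add hsys hloc (hsub hx1).1,
    gluedValue_eq_add hsys hloc (hsub hy1).1, Real.coe_toNNReal _ (by positivity), add_mul, abs_le]
  constructor <;> linarith [h1.1, h1.2, h2.1, h2.2]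

/-- Blow-up of the value at the boundary of the region of null-controllability. -/
theorem tendsto_gluedValue_of_frontier (hsys : SystemHyp f U G G₁)
    (hconv : ConvexVelocities f U G) (hloc : LocalCLFHyp f U G Ω V c)
    (hcost : RunningCostHyp U G g (sublevel Ω V c)) {xs : ℕ → EuclideanSpace ℝ (Fin n)}
    (hxs : ∀ k, xs k ∈ nullControllable f U G G₁)
    (hx : x ∈ frontier (nullControllable f U G G₁) ∩ G) (hlim : Tendsto xs atTop (𝓝 x)) :
    Tendsto (fun k => (gluedValue f U G₁ Ω V c g (xs k)).toReal) atTop atTop := by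
  rw [tendsto_atTop]
  intro b
  -- The correction is at least `-c`, so a glued value below `b` means an exit value at most `b +
  -- c`. The comparison then puts `x` itself into the open set `D₀`, although it is a boundary
  -- point.
  obtain ⟨r, hr, Λ, hΛ, h⟩ := exists_local_comparison hsys hconv hloc hcost hx.2 (b + c)
  filter_upwards [hlim.eventually_mem (Metric.ball_mem_nhds x hr)] with k hk
  by_contra! hlt
  rw [gluedValue_eq_add hsys hloc (hxs k).1] at hlt
  have hW : exitValue f U G₁ c g (sublevel Ω V c) (xs k) ≤ ENNReal.ofReal (b + c) := by
    rw [← ENNReal.ofReal_toReal (exitValue_lt_top hsys hloc hcost (hxs k)).ne]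
    exact ENNReal.ofReal_le_ofReal (by linarith [(hloc.gluing_mem (x := xs k)).1])
  have hxD := (h _ hk x (Metric.mem_ball_self hr) hW).1
  have hfr := (isOpen_nullControllable hsys hconv hloc hcost).frontier_eq ▸ hx.1
  exact hfr.2 hxD

/-- The exit-time value grows at least linearly at infinity. -/
theorem exists_linear_growth (hsys : SystemHyp f U G G₁) (hloc : LocalCLFHyp f U G Ω V c)
    (hdom : CostDominatesSpeed f U G g) : ∃ R C : ℝ, 0 < C ∧ ∀ x ∈ G,
      ENNReal.ofReal (C * (‖x‖ - R)) ≤ exitValue f U G₁ c g (sublevel Ω V c) x := by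
  obtain ⟨R₀, C, hR₀, hC, hg⟩ := hdom
  obtain ⟨R₁, hR₁⟩ := (hloc.isCompact_sublevel c).isBounded.subset_closedBall 0
  set R := max R₀ R₁ with hR
  refine ⟨R, C, hC, fun x hx => ?_⟩
  by_contra! hlt
  obtain ⟨u, T, hu, hT, hTK, -, hcostlt⟩ :=
    hsys.exists_of_exitValue_lt (hloc.isCompact_sublevel c).isClosed hx hlt
  have hxc : ContinuousOn (sol f G₁ x u) (Icc 0 T) :=
    (hsys.continuousOn_sol hx hu).mono Icc_subset_Ici_self
  have hScpt : IsCompact (Icc 0 T ∩ {t | ‖sol f G₁ x u t‖ ≤ R}) := by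
    refine isCompact_Icc.of_isClosed_subset ?_ inter_subset_left
    exact hxc.norm.preimage_isClosed_of_isClosed isClosed_Icc (isClosed_Iic (a := R))
  have hSne : (Icc 0 T ∩ {t | ‖sol f G₁ x u t‖ ≤ R}).Nonempty :=
    ⟨T, ⟨hT, le_rfl⟩, (mem_closedBall_zero_iff.1 (hR₁ hTK)).trans (le_max_right _ _)⟩
  -- Before the first time `τ` in the ball of radius `R` the cost dominates the speed, and the path
  -- has covered a distance of at least `‖x‖ - R`.
  obtain ⟨τ, ⟨⟨hτ0, hτT⟩, hτR⟩, hleast⟩ := hScpt.exists_isLeast hSne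
  have htr := hsys.isTrajectory_sol hx hu
  have hdist : ‖x‖ - R ≤ ‖∫ t in Ioc 0 τ, f (sol f G₁ x u t) (u t)‖ := by
    rw [← intervalIntegral.integral_of_le hτ0,
      ← htr.sub_eq_integral le_rfl hτ0 (EReal.coe_lt_top τ), hsys.sol_zero hx hu]
    have := norm_sub_norm_le x (sol f G₁ x u τ)
    rw [norm_sub_rev] at this
    have hτR : ‖sol f G₁ x u τ‖ ≤ R := hτR
    linarith
  have hle : ENNReal.ofReal (C * (‖x‖ - R)) ≤ runCost f G₁ g x u τ := by
    calc ENNReal.ofReal (C * (‖x‖ - R))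
        ≤ ENNReal.ofReal (C * ‖∫ t in Ioc 0 τ, f (sol f G₁ x u t) (u t)‖) := by gcongr
      _ = ENNReal.ofReal C * ‖∫ t in Ioc 0 τ, f (sol f G₁ x u t) (u t)‖ₑ := by
          rw [ENNReal.ofReal_mul hC.le, ofReal_norm]
      _ ≤ ENNReal.ofReal C * ∫⁻ t in Ioc 0 τ, ‖f (sol f G₁ x u t) (u t)‖ₑ := by
          gcongr; exact enorm_integral_le_lintegral_enorm _
      _ = ∫⁻ t in Ioc 0 τ, ENNReal.ofReal C * ‖f (sol f G₁ x u t) (u t)‖ₑ :=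
          (lintegral_const_mul' _ _ ENNReal.ofReal_ne_top).symm
      _ ≤ runCost f G₁ g x u τ := by
          unfold runCost
          rw [← restrict_Ioo_eq_restrict_Ioc]
          refine setLIntegral_mono' measurableSet_Ioo fun t ht => ?_
          rw [← ofReal_norm, ← ENNReal.ofReal_mul hC.le]
          refine ENNReal.ofReal_le_ofReal (hg _ ⟨hsys.sol_mem hx hu ht.1.le, fun hb => ?_⟩ _
            (hu.2 t ht.1.le))
          refine absurd (hleast ⟨⟨ht.1.le, ht.2.le.trans hτT⟩, ?_⟩) (not_le.2 ht.2)
          exact (mem_ball_zero_iff.1 hb).le.trans (le_max_left _ _)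
  exact absurd (hle.trans ((runCost_mono hτT).trans le_self_add)) (not_le.2 hcostlt)

/-- Blow-up of the value at infinity. -/
theorem tendsto_gluedValue_of_norm (hsys : SystemHyp f U G G₁) (hloc : LocalCLFHyp f U G Ω V c)
    (hcost : RunningCostHyp U G g (sublevel Ω V c)) (hdom : CostDominatesSpeed f U G g)
    {xs : ℕ → EuclideanSpace ℝ (Fin n)} (hxs : ∀ k, xs k ∈ nullControllable f U G G₁)
    (hlim : Tendsto (fun k => ‖xs k‖) atTop atTop) :
    Tendsto (fun k => (gluedValue f U G₁ Ω V c g (xs k)).toReal) atTop atTop := by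
  obtain ⟨R, C, hC, h⟩ := exists_linear_growth (c := c) hsys hloc hdom
  have hlin : Tendsto (fun k => C * (‖xs k‖ - R) - c) atTop atTop :=
    tendsto_atTop_add_const_right _ _
      ((tendsto_atTop_add_const_right _ (-R) hlim).const_mul_atTop hC)
  refine tendsto_atTop_mono (fun k => ?_) hlin
  rw [gluedValue_eq_add hsys hloc (hxs k).1]
  have h1 := (ENNReal.ofReal_le_iff_le_toReal
    (exitValue_lt_top hsys hloc hcost (hxs k)).ne).1 (h _ (hxs k).1)
  linarith [(hloc.gluing_mem (x := xs k)).1]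

/-- For short times all trajectories from a point stay close to it. -/
theorem SystemHyp.exists_short_time (hsys : SystemHyp f U G G₁) (hx : x ∈ G) :
    ∃ M : ℝ, 0 < M ∧ ∀ N ∈ 𝓝 x, ∃ δ > 0, ∀ u, IsControl U u → ∀ t ∈ Icc 0 δ,
      sol f G₁ x u t ∈ N ∧ ‖sol f G₁ x u t - x‖ ≤ M * t := by
  obtain ⟨r, hr, -, A, hA, hAG, hAs⟩ := hsys.exists_compact_reach hx 1
  obtain ⟨M, hM0, hM⟩ := hsys.exists_bound hA (hAG.trans hsys.closure_subset)
  refine ⟨M, hM0, fun N hN => ?_⟩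
  obtain ⟨ρ, hρ, hρN⟩ := Metric.mem_nhds_iff.1 hN
  refine ⟨min 1 (ρ / (2 * M)), by positivity, fun u hu t ht => ?_⟩
  have h1 := (hsys.isTrajectory_sol hx hu).norm_sub_le (M := M) le_rfl ht.1 (EReal.coe_lt_top t)
    fun s hs => hM _ (hAs x (Metric.mem_ball_self hr) u hu s
      ⟨hs.1, hs.2.trans (ht.2.trans (min_le_left _ _))⟩) _ (hu.2 s hs.1)
  rw [hsys.sol_zero hx hu, sub_zero] at h1
  refine ⟨hρN ?_, h1⟩
  rw [Metric.mem_ball, dist_eq_norm]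
  have h2 := ht.2.trans (min_le_right _ _)
  rw [le_div_iff₀ (by positivity)] at h2
  nlinarith

/-- The data are continuous in the state, uniformly in the control value. -/
theorem eventually_uniform_close (hsys : SystemHyp f U G G₁) (hcost : RunningCostHyp U G g K)
    (hx : x ∈ G) {ε : ℝ} (hε : 0 < ε) :
    ∀ᶠ y in 𝓝 x, ∀ w ∈ U, ‖f y w - f x w‖ ≤ ε ∧ |g y w - g x w| ≤ ε := by
  obtain ⟨r, hr, hrG⟩ := Metric.isOpen_iff.1 hsys.domain_G.1 x hx
  have hsub : Metric.closedBall x (r / 2) ⊆ closure G :=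
    (Metric.closedBall_subset_ball (by linarith)).trans (hrG.trans subset_closure)
  obtain ⟨L, hL0, hL⟩ := hsys.exists_lipschitz (isCompact_closedBall x (r / 2)) hsub
  obtain ⟨L', hL'0, hL'⟩ := hcost.exists_lipschitz (isCompact_closedBall x (r / 2)) hsub
  have hxm : x ∈ Metric.closedBall x (r / 2) := Metric.mem_closedBall_self (by positivity)
  filter_upwards [Metric.closedBall_mem_nhds x (show 0 < r / 2 by positivity),
    Metric.closedBall_mem_nhds x (show 0 < ε / (L + L') by positivity)] with y hy hy' w hw
  rw [Metric.mem_closedBall, dist_eq_norm, le_div_iff₀ (by positivity)] at hy'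
  have h1 := hL y hy x hxm w hw
  have h2 := hL' y hy x hxm w hw
  constructor <;> nlinarith [mul_nonneg hL0.le (norm_nonneg (y - x)),
    mul_nonneg hL'0.le (norm_nonneg (y - x))]

theorem ofReal_integral_le_lintegral {α : Type*} [MeasurableSpace α] {μ : Measure α} {h : α → ℝ}
    (hi : Integrable h μ) : ENNReal.ofReal (∫ a, h a ∂μ) ≤ ∫⁻ a, ENNReal.ofReal (h a) ∂μ := by
  rw [integral_eq_lintegral_pos_part_sub_lintegral_neg_part hi]
  refine (ENNReal.ofReal_le_ofReal (sub_le_self _ ENNReal.toReal_nonneg)).trans ?_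
  exact ENNReal.ofReal_toReal_le

/-- Lower bound of the running cost by a linear functional of the displacement. -/
theorem SystemHyp.le_runCost_of_inner (hsys : SystemHyp f U G G₁) (hx : x ∈ G)
    (hu : IsControl U u) {θ T : ℝ} (hT : 0 ≤ T) (p : EuclideanSpace ℝ (Fin n))
    (h : ∀ t ∈ Icc 0 T, θ ≤ inner ℝ p (f (sol f G₁ x u t) (u t)) + g (sol f G₁ x u t) (u t)) :
    ENNReal.ofReal (θ * T - inner ℝ p (sol f G₁ x u T - x)) ≤ runCost f G₁ g x u T := by
  have htr := hsys.isTrajectory_sol hx hu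
  have hii := htr.intervalIntegrable le_rfl hT (EReal.coe_lt_top T)
  have hi : IntegrableOn (fun t => inner ℝ p (f (sol f G₁ x u t) (u t))) (Ioc 0 T) volume :=
    (innerSL ℝ p).integrable_comp hii.1
  have hinner : inner ℝ p (sol f G₁ x u T - x) =
      ∫ t in Ioc 0 T, inner ℝ p (f (sol f G₁ x u t) (u t)) := by
    have h1 := htr.sub_eq_integral le_rfl hT (EReal.coe_lt_top T)
    rw [hsys.sol_zero hx hu] at h1
    have h2 := (innerSL ℝ p).intervalIntegral_comp_comm hii
    simp only [innerSL_apply_apply] at h2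
    rw [h1, ← h2, intervalIntegral.integral_of_le hT]
  have hconst : IntegrableOn (fun _ : ℝ => θ) (Ioc 0 T) volume := integrableOn_const (by simp)
  -- Integrability of the linear term comes from the trajectory itself, so the lower bound needs no
  -- measurability of the running cost along it.
  have heq : θ * T - inner ℝ p (sol f G₁ x u T - x) =
      ∫ t in Ioc 0 T, (θ - inner ℝ p (f (sol f G₁ x u t) (u t))) := by
    rw [integral_sub hconst hi, hinner]
    simp [hT, mul_comm]
  rw [heq]
  refine (ofReal_integral_le_lintegral (hconst.sub hi)).trans ?_
  refine setLIntegral_mono' measurableSet_Ioc fun t ht => ENNReal.ofReal_le_ofReal ?_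
  have := h t (Ioc_subset_Icc_self ht)
  simp only [Pi.sub_apply]
  linarith

/-- The subsolution inequality. -/
theorem hamiltonian_nonpos (hsys : SystemHyp f U G G₁) (hloc : LocalCLFHyp f U G Ω V c)
    (hcost : RunningCostHyp U G g (sublevel Ω V c)) {O : Set (EuclideanSpace ℝ (Fin n))}
    (hO : IsOpen O) (hOD : O ⊆ nullControllable f U G G₁) (hx : x ∈ O)
    {φ : EuclideanSpace ℝ (Fin n) → ℝ} {p : EuclideanSpace ℝ (Fin n)} (hφ : HasGradientAt φ p x)
    (hmax : ∀ᶠ y in 𝓝 x, (exitValue f U G₁ c g (sublevel Ω V c) y).toReal - φ y ≤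
      (exitValue f U G₁ c g (sublevel Ω V c) x).toReal - φ x) :
    hamiltonian f U g x p ≤ 0 := by
  have hxG := (hOD hx).1
  refine csSup_le (hloc.nonempty_U.image _) ?_
  rintro _ ⟨w, hw, rfl⟩
  by_contra! hpos
  set θ := -inner ℝ p (f x w) - g x w with hθ
  have hpos : 0 < θ := hpos
  have hwc := isControl_const hw
  -- The speed bound `M` is fixed before the neighbourhood, whose choice below uses the tolerance `θ
  -- / (4 * M)` for the first-order remainder of `φ`.
  obtain ⟨M, hM0, hM⟩ := hsys.exists_short_time hxG
  set ε := θ / (4 * (‖p‖ + 1)) with hε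
  have hε0 : 0 < ε := by positivity
  have hpε : ‖p‖ * ε ≤ θ / 4 := by
    rw [hε, mul_div_assoc', div_le_div_iff₀ (by positivity) (by positivity)]
    nlinarith [norm_nonneg p]
  obtain ⟨δ, hδ0, hδ⟩ := hM _ (hmax.and ((eventually_abs_sub_inner_le hφ (show 0 < θ / (4 * M) by positivity)).and
    ((eventually_uniform_close hsys hcost hxG hε0).and ((eventually_uniform_close hsys hcost hxG
      (show 0 < θ / 4 by positivity)).and (hO.mem_nhds hx)))))
  have hin := hδ _ hwc
  obtain ⟨⟨hmaxδ, hφδ, -, -, hOδ⟩, hMδ⟩ := hin δ ⟨hδ0.le, le_rfl⟩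
  set y := sol f G₁ x (fun _ => w) δ with hy
  have hdp := hsys.exitValue_le_add (c := c) (g := g) (hloc.isCompact_sublevel c).isClosed hxG hwc hδ0.le
  have hrc : runCost f G₁ g x (fun _ => w) δ ≤ ENNReal.ofReal ((g x w + θ / 4) * δ) :=
    runCost_le hδ0.le fun t ht => by
      obtain ⟨⟨-, -, -, h4, -⟩, -⟩ := hin t ht
      linarith [(abs_le.1 (h4 w hw).2).2]
  have hg0 := hcost.nonneg x (subset_closure hxG) w hw
  have hxt := (exitValue_lt_top hsys hloc hcost (hOD hx)).ne
  have hyt := (exitValue_lt_top hsys hloc hcost (hOD hOδ)).ne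
  have hreal : (exitValue f U G₁ c g (sublevel Ω V c) x).toReal ≤
      (g x w + θ / 4) * δ + (exitValue f U G₁ c g (sublevel Ω V c) y).toReal := by
    have h1 := ENNReal.toReal_mono (ENNReal.add_ne_top.2 ⟨ENNReal.ofReal_ne_top, hyt⟩)
      (hdp.trans (add_le_add_left hrc _))
    rwa [ENNReal.toReal_add ENNReal.ofReal_ne_top hyt, ENNReal.toReal_ofReal (by positivity)] at h1
  have hinner : inner ℝ p (y - x) ≤ (inner ℝ p (f x w) + θ / 4) * δ := by
    have htr := hsys.isTrajectory_sol hxG hwc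
    have h1 := htr.sub_eq_integral le_rfl hδ0.le (EReal.coe_lt_top δ)
    have hii := htr.intervalIntegrable le_rfl hδ0.le (EReal.coe_lt_top δ)
    rw [hsys.sol_zero hxG hwc] at h1
    have h2 := (innerSL ℝ p).intervalIntegral_comp_comm hii
    simp only [innerSL_apply_apply] at h2
    rw [hy, h1, ← h2]
    have hii' : IntervalIntegrable (fun σ => inner ℝ p (f (sol f G₁ x (fun _ => w) σ) w)) volume 0 δ :=
      ⟨(innerSL ℝ p).integrable_comp hii.1, (innerSL ℝ p).integrable_comp hii.2⟩
    refine (intervalIntegral.integral_mono_on hδ0.le hii' intervalIntegrable_const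
      (g := fun _ => inner ℝ p (f x w) + θ / 4) fun s hs => ?_).trans (by simp; linarith)
    obtain ⟨⟨-, -, h3, -, -⟩, -⟩ := hin s hs
    have h4 := real_inner_le_norm p (f (sol f G₁ x (fun _ => w) s) w - f x w)
    rw [inner_sub_right] at h4
    have h5 : ‖p‖ * ‖f (sol f G₁ x (fun _ => w) s) w - f x w‖ ≤ ‖p‖ * ε := by
      gcongr; exact (h3 w hw).1
    linarith
  have hsmall : θ / (4 * M) * ‖y - x‖ ≤ θ / 4 * δ := by
    calc θ / (4 * M) * ‖y - x‖ ≤ θ / (4 * M) * (M * δ) := by gcongr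
      _ = θ / 4 * δ := by field_simp
  have h6 := (abs_le.1 hφδ).2
  -- The running cost, the linear term and the remainder each lose at most `θ / 4 * δ`, in total
  -- less than `θ * δ`.
  nlinarith [mul_pos hpos hδ0]

/-- The supersolution inequality. -/
theorem hamiltonian_nonneg (hsys : SystemHyp f U G G₁) (hloc : LocalCLFHyp f U G Ω V c)
    (hcost : RunningCostHyp U G g (sublevel Ω V c)) {O : Set (EuclideanSpace ℝ (Fin n))}
    (hO : IsOpen O) (hOD : O ⊆ nullControllable f U G G₁) (hOK : Disjoint O (sublevel Ω V c))
    (hx : x ∈ O) {φ : EuclideanSpace ℝ (Fin n) → ℝ} {p : EuclideanSpace ℝ (Fin n)}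
    (hφ : HasGradientAt φ p x)
    (hmin : ∀ᶠ y in 𝓝 x, (exitValue f U G₁ c g (sublevel Ω V c) x).toReal - φ x ≤
      (exitValue f U G₁ c g (sublevel Ω V c) y).toReal - φ y) :
    0 ≤ hamiltonian f U g x p := by
  have hxG := (hOD hx).1
  have hxG' := subset_closure hxG
  by_contra! hneg
  set θ := -hamiltonian f U g x p with hθ
  have hθ0 : 0 < θ := neg_pos.2 hneg
  have hbdd : BddAbove ((fun u => -inner ℝ p (f x u) - g x u) '' U) := by
    obtain ⟨M, -, hM⟩ := hsys.exists_bound (isCompact_singleton (x := x))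
      (singleton_subset_iff.2 (hsys.subset hxG))
    refine ⟨‖p‖ * M, ?_⟩
    rintro _ ⟨w, hw, rfl⟩
    have h1 := (abs_le.1 (abs_real_inner_le_norm p (f x w))).1
    have h2 : ‖p‖ * ‖f x w‖ ≤ ‖p‖ * M := by gcongr; exact hM x rfl w hw
    have h3 := hcost.nonneg x hxG' w hw
    simp only
    linarith
  have hle : ∀ w ∈ U, θ ≤ inner ℝ p (f x w) + g x w := fun w hw => by
    have h1 : -inner ℝ p (f x w) - g x w ≤ hamiltonian f U g x p :=
      le_csSup hbdd (mem_image_of_mem _ hw)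
    linarith
  obtain ⟨M, hM0, hM⟩ := hsys.exists_short_time hxG
  set ε := θ / (2 * (‖p‖ + 1)) with hε
  have hε0 : 0 < ε := by positivity
  have hpε : (‖p‖ + 1) * ε = θ / 2 := by rw [hε]; field_simp
  obtain ⟨δ, hδ0, hδ⟩ := hM _ (hmin.and ((eventually_abs_sub_inner_le hφ (show 0 < θ / (8 * M) by positivity)).and
    ((eventually_uniform_close hsys hcost hxG hε0).and (hO.mem_nhds hx))))
  have hxt := (exitValue_lt_top hsys hloc hcost (hOD hx)).ne
  -- The duration `δ` is uniform in the control, so the control can be chosen afterwards with an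
  -- error proportional to `δ`.
  obtain ⟨u, T, hu, hT, hTK, -, hlt⟩ := hsys.exists_of_exitValue_lt
    (hloc.isCompact_sublevel c).isClosed hxG
    (ENNReal.lt_add_right hxt (show ENNReal.ofReal (θ / 8 * δ) ≠ 0 by
      simpa using (by positivity : 0 < θ / 8 * δ)))
  have hin := hδ _ hu
  -- Up to time `δ` the path remains in `O`, which is disjoint from the target.
  have hδT : δ ≤ T := by
    by_contra! h
    exact hOK.notMem_of_mem_left (hin T ⟨hT, h.le⟩).1.2.2.2 hTK
  obtain ⟨⟨hminδ, hφδ, -, hOδ⟩, hMδ⟩ := hin δ ⟨hδ0.le, le_rfl⟩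
  set y := sol f G₁ x u δ with hy
  have hyt := (exitValue_lt_top hsys hloc hcost (hOD hOδ)).ne
  have hdp := hsys.add_exitValue_le (c := c) (g := g) hxG hu hδ0.le hδT hTK
  have hrc := hsys.le_runCost_of_inner (g := g) hxG hu hδ0.le (θ := θ / 2) p fun t ht => by
    obtain ⟨⟨-, -, h3, -⟩, -⟩ := hin t ht
    obtain ⟨h4, h5⟩ := h3 _ (hu.2 t ht.1)
    have h6 := (abs_le.1 (abs_real_inner_le_norm p (f (sol f G₁ x u t) (u t) - f x (u t)))).1
    rw [inner_sub_right] at h6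
    have h7 : ‖p‖ * ‖f (sol f G₁ x u t) (u t) - f x (u t)‖ ≤ ‖p‖ * ε := by gcongr
    have h8 := (abs_le.1 h5).1
    have h9 := hle _ (hu.2 t ht.1)
    linarith
  have hsum := (add_le_add_left hrc (exitValue f U G₁ c g (sublevel Ω V c) y)).trans
    (hdp.trans hlt.le)
  have hreal : (θ / 2 * δ - inner ℝ p (y - x)) + (exitValue f U G₁ c g (sublevel Ω V c) y).toReal ≤
      (exitValue f U G₁ c g (sublevel Ω V c) x).toReal + θ / 8 * δ := by
    have h1 := ENNReal.toReal_mono (ENNReal.add_ne_top.2 ⟨hxt, ENNReal.ofReal_ne_top⟩) hsum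
    rw [ENNReal.toReal_add ENNReal.ofReal_ne_top hyt, ENNReal.toReal_add hxt ENNReal.ofReal_ne_top,
      ENNReal.toReal_ofReal (show 0 ≤ θ / 8 * δ by positivity), ENNReal.toReal_ofReal'] at h1
    linarith [le_max_left (θ / 2 * δ - inner ℝ p (y - x)) 0]
  have hsmall : θ / (8 * M) * ‖y - x‖ ≤ θ / 8 * δ := by
    calc θ / (8 * M) * ‖y - x‖ ≤ θ / (8 * M) * (M * δ) := by gcongr
      _ = θ / 8 * δ := by field_simp
  have h6 := (abs_le.1 hφδ).1
  -- The gain `θ / 2 * δ` exceeds the sum of the suboptimality `θ / 8 * δ` and the remainder `θ / 8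
  -- * δ`.
  nlinarith [mul_pos hθ0 hδ0]

theorem isViscositySolution_gluedValue (hsys : SystemHyp f U G G₁)
    (hconv : ConvexVelocities f U G) (hloc : LocalCLFHyp f U G Ω V c)
    (hcost : RunningCostHyp U G g (sublevel Ω V c)) :
    IsViscositySolution (hamiltonian f U g) (nullControllable f U G G₁ \ sublevel Ω V c)
      (fun x => (gluedValue f U G₁ Ω V c g x).toReal) := by
  have hO : IsOpen (nullControllable f U G G₁ \ sublevel Ω V c) :=
    (isOpen_nullControllable hsys hconv hloc hcost).sdiff (hloc.isCompact_sublevel c).isClosed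
  refine ⟨hO, (locallyLipschitzOn_gluedValue hsys hconv hloc hcost).continuousOn.mono sdiff_subset,
    fun x hx φ hφ => ?_⟩
  have hgr : HasGradientAt φ (gradient φ x) x := (hφ.differentiableAt (by norm_num)).hasGradientAt
  have hev : ∀ᶠ y in 𝓝 x, y ∉ sublevel Ω V c :=
    (hO.eventually_mem hx).mono fun y hy => hy.2
  have heq : ∀ y, y ∉ sublevel Ω V c →
      gluedValue f U G₁ Ω V c g y = exitValue f U G₁ c g (sublevel Ω V c) y := fun y hy => by
    rw [gluedValue, if_neg hy]
  constructor
  · intro hmax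
    have hmax' := hmax
    rw [IsLocalMaxOn, IsMaxFilter, hO.nhdsWithin_eq hx] at hmax'
    refine hamiltonian_nonpos hsys hloc hcost hO sdiff_subset hx hgr ?_
    filter_upwards [hmax', hev] with y hy hyK
    rwa [heq y hyK, heq x hx.2] at hy
  · intro hmin
    have hmin' := hmin
    rw [IsLocalMinOn, IsMinFilter, hO.nhdsWithin_eq hx] at hmin'
    refine hamiltonian_nonneg hsys hloc hcost hO sdiff_subset disjoint_sdiff_left hx hgr ?_
    filter_upwards [hmin', hev] with y hy hyK
    rwa [heq y hyK, heq x hx.2] at hy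

end Regularity

end ExitTime

end

theorem proposition2p19 {n m : ℕ}
    (f : EuclideanSpace ℝ (Fin n) → EuclideanSpace ℝ (Fin m) → EuclideanSpace ℝ (Fin n))
    (g : EuclideanSpace ℝ (Fin n) → EuclideanSpace ℝ (Fin m) → ℝ)
    (U : Set (EuclideanSpace ℝ (Fin m))) (G G₁ Ω : Set (EuclideanSpace ℝ (Fin n)))
    (Vloc : EuclideanSpace ℝ (Fin n) → ℝ) (c : ℝ)
    (hsys : ExitTime.SystemHyp f U G G₁)
    (hconv : ExitTime.ConvexVelocities f U G)
    (hloc : ExitTime.LocalCLFHyp f U G Ω Vloc c)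
    (hcost : ExitTime.RunningCostHyp U G g (ExitTime.sublevel Ω Vloc c))
    (hdom : ExitTime.CostDominatesSpeed f U G g) :
    -- `V` is finite and locally Lipschitz on the region of asymptotic null-controllability
    (∀ x ∈ ExitTime.nullControllable f U G G₁, ExitTime.gluedValue f U G₁ Ω Vloc c g x ≠ ⊤) ∧
    LocallyLipschitzOn (ExitTime.nullControllable f U G G₁)
      (fun x => (ExitTime.gluedValue f U G₁ Ω Vloc c g x).toReal) ∧
    -- the Hamilton-Jacobi-Bellman equation outside the sublevel set
    ExitTime.IsViscositySolution (ExitTime.hamiltonian f U g)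
      (ExitTime.nullControllable f U G G₁ \ ExitTime.sublevel Ω Vloc c)
      (fun x => (ExitTime.gluedValue f U G₁ Ω Vloc c g x).toReal) ∧
    -- blow-up at the boundary (in the state space `G`) and at infinity
    ∀ xs : ℕ → EuclideanSpace ℝ (Fin n), (∀ k, xs k ∈ ExitTime.nullControllable f U G G₁) →
      ((∃ x' ∈ frontier (ExitTime.nullControllable f U G G₁) ∩ G, Tendsto xs atTop (𝓝 x')) ∨
        Tendsto (fun k => ‖xs k‖) atTop atTop) →
      Tendsto (fun k => (ExitTime.gluedValue f U G₁ Ω Vloc c g (xs k)).toReal) atTop atTop := by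
  refine ⟨fun x hx => ExitTime.gluedValue_ne_top hsys hloc hcost hx,
    ExitTime.locallyLipschitzOn_gluedValue hsys hconv hloc hcost,
    ExitTime.isViscositySolution_gluedValue hsys hconv hloc hcost, ?_⟩
  rintro xs hxs (⟨x', hx', hlim⟩ | hlim)
  · exact ExitTime.tendsto_gluedValue_of_frontier hsys hconv hloc hcost hxs hx' hlim
  · exact ExitTime.tendsto_gluedValue_of_norm hsys hloc hcost hdom hxs hlim
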